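/- Let $(\mathsf X,\mathcal X)$ and $(\mathsf Y,\mathcal Y)$ be measurable spaces with $\mathcal X$ countably generated. Consider a hidden Markov model: a Markov kernel $Q$ on $\mathsf X$ and a Markov kernel $G(x,dy)=g(x,y)\,\lambda(dy)$ from $\mathsf X$ to $\mathsf Y$, where $\lambda$ is $\sigma$-finite and $g\ge 0$ is jointly measurable; write $g_y=g(\cdot,y)$. For $y_k,\dots,y_m\in\mathsf Y$ put $$L\langle y_{k:m}\rangle(x_k,A)=\int\!\cdots\!\int \mathbf 1_A(x_{m+1})\prod_{\ell=k}^m g_{y_\ell}(x_\ell)\,Q(x_\ell,dx_{\ell+1}),\qquad L\langle y_{k:m}\rangle(x,\cdot)=\delta_x\ \text{ if } k>m.$$ Write $\mu f=\int f\,d\mu$. For a probability measure $\chi$ on $\mathsf X$ define the predictor $\phi_\chi\langle y_{0:n-1}\rangle(A)=\chi L\langle y_{0:n-1}\rangle\mathbf 1_A/\chi L\langle y_{0:n-1}\rangle\mathbf 1_{\mathsf X}$ (equal to $\chi$ for $n=0$), and the filter $\bar\phi_\chi\langle y_{0:n}\rangle(A)=\phi_\chi\langle y_{0:n-1}\rangle(g_{y_n}\mathbf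 1_A)/\phi_\chi\langle y_{0:n-1}\rangle g_{y_n}$. Define $$\sigma_\chi^2\langle y_{0:n-1}\rangle(f)=\sum_{k=0}^n\phi_\chi\langle y_{0:k-1}\rangle\left(\frac{L\langle y_{k:n-1}\rangle f-\phi_\chi\langle y_{0:n-1}\rangle f\cdot L\langle y_{k:n-1}\rangle\mathbf 1_{\mathsf X}}{\phi_\chi\langle y_{0:k-1}\rangle L\langle y_{k:n-1}\rangle\mathbf 1_{\mathsf X}}\right)^{2},$$ $$\tilde\sigma_\chi^2\langle y_{0:n}\rangle(h)=\frac{\sigma_\chi^2\langle y_{0:n-1}\rangle\big(g_{y_n}\{h-\bar\phi_\chi\langle y_{0:n}\rangle h\}\big)}{\big(\phi_\chi\langle y_{0:n-1}\rangle g_{y_n}\big)^2},\qquad \tilde\sigma_\chi=\sqrt{\tilde\sigma_\chi^2}.$$ Let $(Y_n)_{n\in\mathbb N}$ be a stationary $\mathsf Y$-valued sequence on a probability space $(\Omega,\mathcal A,\mathbb P)$. On the same space let, for each $N\ge1$, $(\xi_n^{N,i})_{n\in\mathbb N,\,1\le i\le N}$ be the particles of the bootstrap particle filter run on $(Y_n)$: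 conditionally on $(Y_m)_{m\in\mathbb N}$ the initial particles $\xi_0^{N,1},\dots,\xi_0^{N,N}$ are i.i.d. from $\chi$, and conditionally on $(Y_m)_{m\in\mathbb N}$ and all particles up to time $n$, the particles $\xi_{n+1}^{N,1},\dots,\xi_{n+1}^{N,N}$ are i.i.d. from $\sum_{i=1}^N\frac{g(\xi_n^{N,i},Y_n)}{\sum_{j}g(\xi_n^{N,j},Y_n)}Q(\xi_n^{N,i},\cdot)$. The particle filter approximation is $\bar\phi_\chi^N\langle Y_{0:n}\rangle=\sum_{i=1}^N\frac{g(\xi_n^{N,i},Y_n)}{\sum_{j}g(\xi_n^{N,j},Y_n)}\delta_{\xi_n^{N,i}}$. **Theorem.** Assume (A2): $g(x,y)>0$ for all $(x,y)\in\mathsf X\times\mathsf Y$, and $\mathbb E[\ln^+\|g_{Y_0}\|_\infty]<\infty$. Then for every bounded measurable $h:\mathsf X\to\mathbb R$, every real $p>0$, every probability measure $\chi$ on $\mathsf X$ and every $n\in\mathbb N$, $\mathbb P$-almost surely, $$\lim_{N\to\infty}\sqrt N\;\mathbb E\Big[\big|\bar\phi^N_\chi\langle Y_{0:n}\rangle h-\bar\phi_\chi\langle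 Y_{0:n}\rangle h\big|^p\,\Big|\,Y_{0:n}\Big]^{1/p}=\sqrt2\;\tilde\sigma_\chi\langle Y_{0:n}\rangle(h)\left(\frac{\Gamma((p+1)/2)}{\sqrt{\pi}}\right)^{1/p}.$$ -/

import Mathlib

open MeasureTheory ProbabilityTheory Filter
open scoped ENNReal Topology

noncomputable section

/-- A hidden Markov model on the state space `X` and the observation space `Y`: the transition kernel
`Q` of the hidden chain, the observation kernel `G`, and a density `g` of `G` with respect to a
σ-finite reference measure. The initial distribution is kept separate. -/
structure HiddenMarkovModel (X Y : Type*) [MeasurableSpace X] [MeasurableSpace Y] where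
  Q : Kernel X X
  markov_Q : IsMarkovKernel Q
  G : Kernel X Y
  markov_G : IsMarkovKernel G
  ref : Measure Y
  sigmaFinite_ref : SigmaFinite ref
  g : X → Y → ℝ
  measurable_g : Measurable (Function.uncurry g)
  g_nonneg : ∀ x y, 0 ≤ g x y
  G_eq : ∀ x, G x = ref.withDensity (fun y => ENNReal.ofReal (g x y))

attribute [instance] HiddenMarkovModel.markov_Q HiddenMarkovModel.markov_G
  HiddenMarkovModel.sigmaFinite_ref

namespace HiddenMarkovModel

variable {X Y : Type*} [MeasurableSpace X] [MeasurableSpace Y] (M : HiddenMarkovModel X Y)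

/-- The one-step unnormalized kernel `L⟨y⟩(x, dx') = g(x, y) Q(x, dx')`. -/
def stepKernel (y : Y) : Kernel X X :=
  Kernel.withDensity M.Q (fun x _ => ENNReal.ofReal (M.g x y))

/-- The unnormalized kernel `L⟨y_k, …, y_{n-1}⟩`; it is the identity kernel `δ_x` if `n ≤ k`. -/
def lkh (y : ℕ → Y) (k : ℕ) : ℕ → Kernel X X
  | 0 => Kernel.id
  | n + 1 => if k ≤ n then M.stepKernel (y n) ∘ₖ lkh y k n else Kernel.id

/-- The function `L⟨y_k, …, y_{n-1}⟩ f`. -/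
def lkhFun (y : ℕ → Y) (k n : ℕ) (f : X → ℝ) (x : X) : ℝ :=
  ∫ x', f x' ∂(M.lkh y k n x)

/-- The predictor `φ_χ⟨y_0, …, y_{n-1}⟩ = χ L⟨y_{0:n-1}⟩ / χ L⟨y_{0:n-1}⟩ 1`. -/
def pred (χ : Measure X) (y : ℕ → Y) (n : ℕ) : Measure X :=
  ((χ.bind (M.lkh y 0 n)) Set.univ)⁻¹ • χ.bind (M.lkh y 0 n)

/-- The updating step: the measure `μ` reweighted by `g(·, y)` and normalized. -/
def update (y : Y) (μ : Measure X) : Measure X :=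
  (∫⁻ x, ENNReal.ofReal (M.g x y) ∂μ)⁻¹ • μ.withDensity (fun x => ENNReal.ofReal (M.g x y))

/-- Updating followed by prediction: one step of the predictor recursion. -/
def feynmanKac (y : Y) (μ : Measure X) : Measure X :=
  (M.update y μ).bind M.Q

/-- The filter `φ̄_χ⟨y_0, …, y_n⟩`. -/
def filt (χ : Measure X) (y : ℕ → Y) (n : ℕ) : Measure X :=
  M.update (y n) (M.pred χ y n)

/-- The asymptotic variance `σ²_χ⟨y_0, …, y_{n-1}⟩(f)` of the particle predictor. -/
def predVariance (χ : Measure X) (y : ℕ → Y) (n : ℕ) (f : X → ℝ) : ℝ :=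
  ∑ k ∈ Finset.range (n + 1),
    ∫ x, ((M.lkhFun y k n f x - (∫ x', f x' ∂(M.pred χ y n)) * M.lkhFun y k n (fun _ => 1) x) /
        (∫ x', M.lkhFun y k n (fun _ => 1) x' ∂(M.pred χ y k))) ^ 2 ∂(M.pred χ y k)

/-- The asymptotic variance `σ̃²_χ⟨y_0, …, y_n⟩(h)` of the particle filter. -/
def filtVariance (χ : Measure X) (y : ℕ → Y) (n : ℕ) (h : X → ℝ) : ℝ :=
  M.predVariance χ y n (fun x => M.g x (y n) * (h x - ∫ x', h x' ∂(M.filt χ y n))) /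
    (∫ x, M.g x (y n) ∂(M.pred χ y n)) ^ 2

/-- The empirical measure of `N` points. -/
def empirical {N : ℕ} (x : Fin N → X) : Measure X :=
  (N : ℝ≥0∞)⁻¹ • ∑ i, Measure.dirac (x i)

/-- The particle filter approximation, that is, the weighted empirical measure
`∑ᵢ (ωᵢ / ∑ⱼ ωⱼ) δ_{xᵢ}` with `ωᵢ = g(xᵢ, y)`. -/
def partFilt {N : ℕ} (y : Y) (x : Fin N → X) : Measure X :=
  M.update y (empirical x)

/-- The supremum norm of the local likelihood `g(·, y)`, as an extended nonnegative number. -/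
def supLikelihood (y : Y) : ℝ≥0∞ := ⨆ x, ENNReal.ofReal (M.g x y)

variable {Ω : Type*} [MeasurableSpace Ω]

/-- `ξ n i` is the `i`-th particle at time `n` of a bootstrap particle filter with `N` particles, run
on the observations `obs` with initial distribution `χ`: given the observations, the initial particles
are i.i.d. from `χ`; given the observations and the particles up to time `n`, the particles at time
`n + 1` are i.i.d. from the mixture `∑ᵢ (ωᵢ / ∑ⱼ ωⱼ) Q(ξ n i, ·)`. -/
structure IsBootstrapFilter (χ : Measure X) (P : Measure Ω) (obs : ℕ → Ω → Y) (N : ℕ)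
    (ξ : ℕ → Fin N → Ω → X) : Prop where
  measurable_particle : ∀ n i, Measurable (ξ n i)
  init : ∀ A : Fin N → Set X, (∀ i, MeasurableSet (A i)) →
    P[Set.indicator {ω | ∀ i, ξ 0 i ω ∈ A i} (fun _ => (1 : ℝ)) |
        MeasurableSpace.comap (fun ω k => obs k ω) inferInstance]
      =ᵐ[P] fun _ => ∏ i, χ.real (A i)
  step : ∀ n, ∀ A : Fin N → Set X, (∀ i, MeasurableSet (A i)) →
    P[Set.indicator {ω | ∀ i, ξ (n + 1) i ω ∈ A i} (fun _ => (1 : ℝ)) |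
        MeasurableSpace.comap (fun ω k => obs k ω) inferInstance ⊔
          MeasurableSpace.comap (fun ω (m : Fin (n + 1)) i => ξ m i ω) inferInstance]
      =ᵐ[P] fun ω => ∏ i, (M.feynmanKac (obs n ω) (empirical fun j => ξ n j ω)).real (A i)

/-- Assumption on the likelihood and the law of `Y_0`: `g` is positive everywhere and
`E[ln⁺ ‖g(·, Y_0)‖_∞] < ∞`. -/
structure LikelihoodAssumption (P : Measure Ω) (obs : ℕ → Ω → Y) : Prop where
  pos : ∀ x y, 0 < M.g x y
  aemeasurable_sup : AEMeasurable M.supLikelihood (P.map (obs 0))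
  lintegral_log_lt_top :
    ∫⁻ y, (ENNReal.log (M.supLikelihood y)).toENNReal ∂(P.map (obs 0)) < ∞

end HiddenMarkovModel

/-- A (strictly) stationary sequence of random variables. -/
structure IsStationarySeq {Y Ω : Type*} [MeasurableSpace Y] [MeasurableSpace Ω] (P : Measure Ω)
    (obs : ℕ → Ω → Y) : Prop where
  measurable_obs : ∀ n, Measurable (obs n)
  shift_eq : ∀ m, P.map (fun ω k => obs (k + m) ω) = P.map (fun ω k => obs k ω)

end

noncomputable section

/-! ### Elementary estimates -/

/-! Fix a sequence of observations along which every likelihood g(·, y_k) is bounded; by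
stationarity and the logarithmic moment almost every sequence is of this kind. Given the
observations, the particles at time n have the explicit law `particleLaw`, so the claim becomes one
about moments of the filter error under these measures as N grows.

A central limit theorem is proved by induction on time, as a bound K/√N on the distance between
characteristic functions (`exists_charFun_predErr`). By `predErr_succ_eq_add`, the rescaled
predictor error at time n + 1 is the error of N i.i.d. draws, given the particles at time n, plus
the filter error at time n for the function Qf. The first part is nearly Gaussian, uniformly over
the sampled law (`norm_integral_pi_cexp_sampleMean_sub_le`), and its random conditional variance is
within O(1/√N) of its limit in mean. The second is a ratio, which is linearized around its
deterministic denominator. The two variances add up as in the recursion `predVariance_succ`.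

The random denominator has no positive lower bound. None is needed: the centered numerator is at
most 2C times the denominator when |f| ≤ C, so the ratio is bounded anyway
(`abs_div_le_of_abs_le_mul`).

The same induction with Hoeffding's inequality bounds all exponential moments of the errors
uniformly in N (`exists_expMoment_predErr_le`). Convergence in law therefore gives convergence of
absolute p-th moments, whose Gaussian value is `integral_abs_rpow_gaussianReal`. Finally
`condExp_particle` identifies the conditional expectation with an integral against `particleLaw`. -/

lemma norm_cexp_I_mul_le_one (x : ℝ) : ‖Complex.exp (Complex.I * x)‖ ≤ 1 := by
  rw [mul_comm, Complex.norm_exp_ofReal_mul_I]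

lemma norm_cexp_I_mul_sub_le (x y : ℝ) :
    ‖Complex.exp (Complex.I * x) - Complex.exp (Complex.I * y)‖ ≤ |x - y| := by
  have h : Complex.exp (Complex.I * x) - Complex.exp (Complex.I * y) =
      Complex.exp (Complex.I * y) * (Complex.exp (Complex.I * (x - y : ℝ)) - 1) := by
    rw [mul_sub, ← Complex.exp_add, mul_one]
    congr 2
    push_cast
    ring
  rw [h, norm_mul]
  have h1 := norm_cexp_I_mul_le_one y
  have h2 := Real.norm_exp_I_mul_ofReal_sub_one_le (x := x - y)
  calc _ ≤ 1 * ‖x - y‖ := by gcongr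
    _ = _ := by simp

/-- For |x| ≤ 1 this is the remainder of the exponential series, with e ≤ 4. For |x| ≥ 1 the two
terms are bounded separately, and 2 + |x| + |x|²/2 ≤ 4|x|³. -/
lemma norm_cexp_I_mul_taylor_two_le (x : ℝ) :
    ‖Complex.exp (Complex.I * x) - (1 + Complex.I * x - x ^ 2 / 2)‖ ≤ 4 * |x| ^ 3 := by
  rcases le_total |x| 1 with hx | hx
  · have h := Complex.norm_exp_sub_sum_le_norm_mul_exp (Complex.I * x) 3
    have h' : ∑ m ∈ Finset.range 3, (Complex.I * x) ^ m / (m.factorial : ℂ) =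
        1 + Complex.I * x - x ^ 2 / 2 := by
      simp [Finset.sum_range_succ, mul_pow]
      ring
    rw [h'] at h
    have hn : ‖Complex.I * (x : ℂ)‖ = |x| := by simp
    rw [hn] at h
    have he : Real.exp |x| ≤ 4 := by
      have := Real.exp_one_lt_d9
      have := Real.exp_le_exp.2 hx
      linarith
    calc _ ≤ _ := h
      _ ≤ |x| ^ 3 * 4 := by gcongr
      _ = _ := by ring
  · have h1 := norm_cexp_I_mul_le_one x
    have h2 : ‖(1 + Complex.I * x - x ^ 2 / 2 : ℂ)‖ ≤ 1 + |x| + |x| ^ 2 / 2 := by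
      refine (norm_sub_le _ _).trans ?_
      gcongr
      · refine (norm_add_le _ _).trans ?_
        simp
      · simp
    refine (norm_sub_le _ _).trans ?_
    nlinarith [mul_nonneg (sub_nonneg.2 hx) (sq_nonneg |x|),
      mul_nonneg (sub_nonneg.2 hx) (abs_nonneg x)]

lemma abs_exp_neg_sub_one_sub_le {w : ℝ} (hw : 0 ≤ w) : |Real.exp (-w) - (1 - w)| ≤ w ^ 2 := by
  have h1 := Real.one_sub_le_exp_neg w
  have h2 : Real.exp (-w) ≤ 1 / (1 + w) := by
    rw [Real.exp_neg, ← one_div]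
    have := Real.add_one_le_exp w
    gcongr
    linarith
  have h3 : 1 / (1 + w) - (1 - w) ≤ w ^ 2 := by
    have : 1 / (1 + w) - (1 - w) = w ^ 2 / (1 + w) := by field_simp; ring
    rw [this]
    exact div_le_self (sq_nonneg w) (by linarith)
  rw [abs_le]
  constructor <;> nlinarith [sq_nonneg w]

lemma abs_exp_neg_sub_exp_neg_le {a b : ℝ} (ha : 0 ≤ a) (hb : 0 ≤ b) :
    |Real.exp (-a) - Real.exp (-b)| ≤ |a - b| := by
  wlog h : a ≤ b generalizing a b
  · rw [abs_sub_comm, abs_sub_comm a]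
    exact this hb ha (le_of_not_ge h)
  have h1 : Real.exp (-b) ≤ Real.exp (-a) := Real.exp_le_exp.2 (by linarith)
  rw [abs_of_nonneg (by linarith), abs_of_nonpos (by linarith)]
  have h2 : Real.exp (-b) = Real.exp (-a) * Real.exp (-(b - a)) := by
    rw [← Real.exp_add]; ring_nf
  have h3 := Real.one_sub_le_exp_neg (b - a)
  have h4 : Real.exp (-a) ≤ 1 := Real.exp_le_one_iff.2 (by linarith)
  have h5 := Real.exp_pos (-a)
  rw [h2]
  nlinarith

/-- Telescoping. It reduces the comparison of the characteristic function of N i.i.d. summands with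
a Gaussian one to a comparison for a single summand. -/
lemma norm_pow_sub_pow_le {a b : ℂ} (ha : ‖a‖ ≤ 1) (hb : ‖b‖ ≤ 1) (n : ℕ) :
    ‖a ^ n - b ^ n‖ ≤ n * ‖a - b‖ := by
  induction n with
  | zero => simp
  | succ n ih =>
    have : a ^ (n + 1) - b ^ (n + 1) = a ^ n * (a - b) + (a ^ n - b ^ n) * b := by ring
    rw [this]
    refine (norm_add_le _ _).trans ?_
    rw [norm_mul, norm_mul, norm_pow]
    have h1 : ‖a‖ ^ n ≤ 1 := pow_le_one₀ (norm_nonneg _) ha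
    calc _ ≤ 1 * ‖a - b‖ + (n * ‖a - b‖) * 1 := by gcongr
      _ = _ := by push_cast; ring

lemma exists_rpow_le_mul_exp {q : ℝ} (hq : 0 ≤ q) :
    ∃ K, 0 ≤ K ∧ ∀ r, 0 ≤ r → r ^ q ≤ K * Real.exp r := by
  obtain ⟨m, hm⟩ := exists_nat_ge q
  -- The 1 serves r ≤ 1, where r^q ≤ 1; the factorial serves r ≥ 1, where r^q ≤ r^m.
  refine ⟨1 + m.factorial, by positivity, fun r hr => ?_⟩
  have h0 := Real.one_le_exp hr
  have h1 := Real.pow_div_factorial_le_exp r hr m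
  rw [div_le_iff₀ (by positivity)] at h1
  rcases le_total r 1 with h | h
  · have := Real.rpow_le_one hr h hq
    have : 0 ≤ (m.factorial : ℝ) * Real.exp r := by positivity
    linarith
  · have := Real.rpow_le_rpow_of_exponent_le h hm
    rw [Real.rpow_natCast] at this
    linarith

lemma sq_le_two_mul_exp_abs (x : ℝ) : x ^ 2 ≤ 2 * Real.exp |x| := by
  have := Real.pow_div_factorial_le_exp |x| (abs_nonneg x) 2
  simp at this
  linarith

/-- The inequality 2uv ≤ u² + v², which splits the exponential moment of a sum of dependent terms at
the price of doubling the exponents. -/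
lemma exp_add_le (a b : ℝ) : Real.exp (a + b) ≤ (Real.exp (2 * a) + Real.exp (2 * b)) / 2 := by
  have h1 : Real.exp (2 * a) = Real.exp a ^ 2 := by rw [← Real.exp_nat_mul]; simp
  have h2 : Real.exp (2 * b) = Real.exp b ^ 2 := by rw [← Real.exp_nat_mul]; simp
  rw [h1, h2, Real.exp_add]
  nlinarith [sq_nonneg (Real.exp a - Real.exp b)]

lemma exp_abs_le (a : ℝ) : Real.exp |a| ≤ Real.exp a + Real.exp (-a) := by
  rcases abs_choice a with h | h <;> rw [h]
  · linarith [Real.exp_pos (-a)]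
  · linarith [Real.exp_pos a]

/-- Bounded measurable real functions. -/
def BddMeas {α : Type*} [MeasurableSpace α] (f : α → ℝ) : Prop :=
  Measurable f ∧ ∃ C, ∀ x, |f x| ≤ C

namespace BddMeas

variable {α : Type*} [MeasurableSpace α] {f g : α → ℝ}

lemma exists_nonneg_bound (hf : BddMeas f) : ∃ C, 0 ≤ C ∧ ∀ x, |f x| ≤ C := by
  obtain ⟨_, C, hC⟩ := hf
  exact ⟨|C|, abs_nonneg _, fun x => (hC x).trans (le_abs_self C)⟩

lemma integrable (hf : BddMeas f) (μ : Measure α) [IsFiniteMeasure μ] : Integrable f μ := by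
  obtain ⟨C, hC⟩ := hf.2
  exact Integrable.of_bound hf.1.aestronglyMeasurable C (ae_of_all _ fun x => by simpa using hC x)

lemma const (c : ℝ) : BddMeas (fun _ : α => c) := ⟨measurable_const, |c|, fun _ => le_rfl⟩

lemma add (hf : BddMeas f) (hg : BddMeas g) : BddMeas (fun x => f x + g x) := by
  obtain ⟨C, hC⟩ := hf.2
  obtain ⟨D, hD⟩ := hg.2
  exact ⟨hf.1.add hg.1, C + D, fun x => (abs_add_le _ _).trans (add_le_add (hC x) (hD x))⟩

lemma neg (hf : BddMeas f) : BddMeas (fun x => - f x) := by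
  obtain ⟨C, hC⟩ := hf.2
  exact ⟨hf.1.neg, C, fun x => by rw [abs_neg]; exact hC x⟩

lemma sub (hf : BddMeas f) (hg : BddMeas g) : BddMeas (fun x => f x - g x) := by
  simpa [sub_eq_add_neg] using hf.add hg.neg

lemma mul (hf : BddMeas f) (hg : BddMeas g) : BddMeas (fun x => f x * g x) := by
  obtain ⟨C, hC0, hC⟩ := hf.exists_nonneg_bound
  obtain ⟨D, _, hD⟩ := hg.exists_nonneg_bound
  refine ⟨hf.1.mul hg.1, C * D, fun x => ?_⟩
  rw [abs_mul]
  exact mul_le_mul (hC x) (hD x) (abs_nonneg _) hC0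

lemma pow (hf : BddMeas f) (k : ℕ) : BddMeas (fun x => f x ^ k) := by
  obtain ⟨C, _, hC⟩ := hf.exists_nonneg_bound
  exact ⟨hf.1.pow_const k, C ^ k, fun x => by rw [abs_pow]; gcongr; exact hC x⟩

lemma div_const (hf : BddMeas f) (c : ℝ) : BddMeas (fun x => f x / c) := by
  simpa [div_eq_mul_inv] using hf.mul (const c⁻¹)

lemma abs (hf : BddMeas f) : BddMeas (fun x => |f x|) := by
  obtain ⟨C, hC⟩ := hf.2
  exact ⟨hf.1.abs, C, fun x => by simpa using hC x⟩

lemma exp (hf : BddMeas f) : BddMeas (fun x => Real.exp (f x)) := by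
  obtain ⟨C, hC⟩ := hf.2
  refine ⟨Real.measurable_exp.comp hf.1, Real.exp C, fun x => ?_⟩
  rw [Real.abs_exp]
  exact Real.exp_le_exp.2 ((le_abs_self _).trans (hC x))

lemma comp {β : Type*} [MeasurableSpace β] (hf : BddMeas f) {φ : β → α} (hφ : Measurable φ) :
    BddMeas (fun x => f (φ x)) := by
  obtain ⟨C, hC⟩ := hf.2
  exact ⟨hf.1.comp hφ, C, fun x => hC _⟩

lemma sum {ι : Type*} (s : Finset ι) {F : ι → α → ℝ} (hF : ∀ i, BddMeas (F i)) :
    BddMeas (fun x => ∑ i ∈ s, F i x) := by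
  classical
  induction s using Finset.induction_on with
  | empty => simpa using const 0
  | insert a s ha ih => simpa [Finset.sum_insert ha] using (hF a).add ih

lemma abs_integral_le {C : ℝ} (hC : ∀ x, |f x| ≤ C) (μ : Measure α) [IsProbabilityMeasure μ] :
    |∫ x, f x ∂μ| ≤ C := by
  simpa using norm_integral_le_of_norm_le_const (μ := μ) (f := f) (ae_of_all _ hC)

lemma kernel_integral {β : Type*} [MeasurableSpace β] (hf : BddMeas f) (κ : Kernel β α)
    [IsMarkovKernel κ] : BddMeas (fun x => ∫ x', f x' ∂(κ x)) := by
  obtain ⟨C, hC⟩ := hf.2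
  exact ⟨(hf.1.stronglyMeasurable.integral_kernel).measurable, C,
    fun x => abs_integral_le hC _⟩

end BddMeas

lemma integrable_cexp_I_mul {α : Type*} [MeasurableSpace α] {f : α → ℝ} (hf : Measurable f)
    (μ : Measure α) [IsFiniteMeasure μ] : Integrable (fun x => Complex.exp (Complex.I * f x)) μ :=
  Integrable.of_bound (by fun_prop) 1 (ae_of_all _ fun x => norm_cexp_I_mul_le_one _)

lemma norm_integral_cexp_I_mul_le_one {α : Type*} [MeasurableSpace α] (f : α → ℝ)
    (μ : Measure α) [IsProbabilityMeasure μ] : ‖∫ x, Complex.exp (Complex.I * f x) ∂μ‖ ≤ 1 := by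
  simpa using norm_integral_le_of_norm_le_const (μ := μ)
    (f := fun x => Complex.exp (Complex.I * f x))
    (ae_of_all _ fun x => norm_cexp_I_mul_le_one (f x))

/-! ### Empirical means of independent samples -/

section IID

/-- The mean of `f` over the points `x 0, …, x (N - 1)`. -/
def sampleMean {X : Type*} {N : ℕ} (f : X → ℝ) (x : Fin N → X) : ℝ := (∑ i, f (x i)) / N

lemma BddMeas.sampleMean {X : Type*} [MeasurableSpace X] {f : X → ℝ} (hf : BddMeas f) (N : ℕ) :
    BddMeas (fun x : Fin N → X => sampleMean f x) :=
  (BddMeas.sum _ fun i => hf.comp (measurable_pi_apply i)).div_const _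

lemma sqrt_mul_sampleMean_sub {X : Type*} {N : ℕ} (hN : 0 < N) (f : X → ℝ) (x : Fin N → X) (m : ℝ) :
    √(N : ℝ) * (sampleMean f x - m) = ∑ i, (√(N : ℝ))⁻¹ * (f (x i) - m) := by
  have hN' : (0 : ℝ) < N := by exact_mod_cast hN
  have hs : √(N : ℝ) * √(N : ℝ) = N := Real.mul_self_sqrt hN'.le
  have hs' : √(N : ℝ) ≠ 0 := (Real.sqrt_pos.2 hN').ne'
  rw [← Finset.mul_sum, Finset.sum_sub_distrib, sampleMean]
  simp only [Finset.sum_const, Finset.card_univ, Fintype.card_fin, nsmul_eq_mul]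
  field_simp
  rw [sq, hs]

variable {X : Type*} [MeasurableSpace X] (ν : Measure X) [IsProbabilityMeasure ν]

/-- Hoeffding: a variable with values in [-C, C] is sub-Gaussian with variance proxy C², and N
independent factors at s/√N multiply to a bound free of N and of ν. -/
lemma integral_pi_exp_sampleMean_le {f : X → ℝ} (hf : Measurable f) {C : ℝ}
    (hC : ∀ x, |f x| ≤ C) (s : ℝ) {N : ℕ} (hN : 0 < N) :
    ∫ x : Fin N → X, Real.exp (s * (√(N : ℝ) * (sampleMean f x - ∫ z, f z ∂ν)))
      ∂(Measure.pi fun _ => ν) ≤ Real.exp (C ^ 2 * s ^ 2 / 2) := by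
  have hN' : (0 : ℝ) < N := by exact_mod_cast hN
  have hs : √(N : ℝ) ^ 2 = N := Real.sq_sqrt hN'.le
  have h1 : ∀ x : Fin N → X, Real.exp (s * (√(N : ℝ) * (sampleMean f x - ∫ z, f z ∂ν))) =
      ∏ i, Real.exp (s / √N * (f (x i) - ∫ z, f z ∂ν)) := by
    intro x
    rw [sqrt_mul_sampleMean_sub hN, Finset.mul_sum, Real.exp_sum]
    refine Finset.prod_congr rfl fun i _ => ?_
    congr 1
    ring
  simp_rw [h1]
  rw [integral_fintype_prod_eq_pow (fun z => Real.exp (s / √N * (f z - ∫ z, f z ∂ν))),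
    Fintype.card_fin]
  have h2 := (hasSubgaussianMGF_of_mem_Icc (μ := ν) (X := f) (a := -C) (b := C) hf.aemeasurable
    (ae_of_all _ fun x => abs_le.1 (hC x))).mgf_le (s / √N)
  simp only [mgf] at h2
  calc _ ≤ (Real.exp ((((‖C - -C‖₊ / 2) ^ 2 : NNReal) : ℝ) * (s / √N) ^ 2 / 2)) ^ N := by
        gcongr
    _ = _ := by
      rw [← Real.exp_nat_mul]
      congr 1
      push_cast
      rw [div_pow s, hs, div_pow, Real.norm_eq_abs, sq_abs]
      field_simp
      ring

lemma integral_pi_exp_abs_sampleMean_le {f : X → ℝ} (hf : Measurable f) {C : ℝ}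
    (hC : ∀ x, |f x| ≤ C) {s : ℝ} (hs : 0 ≤ s) {N : ℕ} (hN : 0 < N) :
    ∫ x : Fin N → X, Real.exp (s * |√(N : ℝ) * (sampleMean f x - ∫ z, f z ∂ν)|)
      ∂(Measure.pi fun _ => ν) ≤ 2 * Real.exp (C ^ 2 * s ^ 2 / 2) := by
  have hb : BddMeas (fun x : Fin N → X => √(N : ℝ) * (sampleMean f x - ∫ z, f z ∂ν)) :=
    (BddMeas.const _).mul ((BddMeas.sampleMean ⟨hf, C, hC⟩ N).sub (BddMeas.const _))
  have e1 := ((BddMeas.const s).mul hb.abs).exp.integrable (Measure.pi fun _ => ν)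
  have e2 := ((BddMeas.const s).mul hb).exp.integrable (Measure.pi fun _ => ν)
  have e3 := ((BddMeas.const (-s)).mul hb).exp.integrable (Measure.pi fun _ => ν)
  have h1 := integral_pi_exp_sampleMean_le ν hf hC s hN
  have h2 := integral_pi_exp_sampleMean_le ν hf hC (-s) hN
  rw [neg_sq] at h2
  have h3 := integral_mono e1 (e2.add e3) (fun x => by
    have := exp_abs_le (s * (√(N : ℝ) * (sampleMean f x - ∫ z, f z ∂ν)))
    rw [abs_mul, abs_of_nonneg hs] at this
    simpa only [Pi.add_apply, neg_mul] using this)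
  simp only [Pi.add_apply] at h3
  rw [integral_add e2 e3] at h3
  linarith

/-- With u = t/√N, both terms are N-th powers of numbers of modulus at most 1, and each base differs
from 1 - u²v/2 by O(|u|³) or O(u⁴), the centering removing the linear term. It is essential that the
constant depends on t and C only: later ν is a random mixture built from the previous particles. -/
lemma norm_integral_pi_cexp_sampleMean_sub_le {f : X → ℝ} (hf : Measurable f) {C : ℝ}
    (hC : ∀ x, |f x| ≤ C) (t : ℝ) {N : ℕ} (hN : 0 < N) :
    ‖(∫ x : Fin N → X, Complex.exp (Complex.I *
        ((t * (√(N : ℝ) * (sampleMean f x - ∫ z, f z ∂ν)) : ℝ) : ℂ)) ∂(Measure.pi fun _ => ν)) -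
      ((Real.exp (-(t ^ 2 * (∫ z, (f z - ∫ z, f z ∂ν) ^ 2 ∂ν) / 2)) : ℝ) : ℂ)‖ ≤
    (32 * |t| ^ 3 * C ^ 3 + 4 * t ^ 4 * C ^ 4) / √N := by
  have hN' : (0 : ℝ) < N := by exact_mod_cast hN
  have hsp : 0 < √(N : ℝ) := Real.sqrt_pos.2 hN'
  have hs : √(N : ℝ) ^ 2 = N := Real.sq_sqrt hN'.le
  have hs1 : 1 ≤ √(N : ℝ) := Real.one_le_sqrt.2 (by exact_mod_cast hN)
  set m := ∫ z, f z ∂ν with hm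
  set v := ∫ z, (f z - m) ^ 2 ∂ν with hv
  set u := t / √(N : ℝ) with hu
  have hut : u ^ 2 * N = t ^ 2 := by rw [hu, div_pow, hs]; field_simp
  have hfb : BddMeas f := ⟨hf, C, hC⟩
  have hmC : |m| ≤ C := BddMeas.abs_integral_le hC ν
  have hd : ∀ z, |f z - m| ≤ 2 * C := fun z => by
    have := abs_sub (f z) m
    linarith [hC z, hmC]
  have hC0 : 0 ≤ C := (abs_nonneg m).trans hmC
  have hd2 : ∀ z, |(f z - m) ^ 2| ≤ (2 * C) ^ 2 := fun z => by
    rw [abs_pow]; gcongr; exact hd z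
  have hv0 : 0 ≤ v := integral_nonneg fun z => sq_nonneg _
  have hvC : v ≤ (2 * C) ^ 2 := (le_abs_self v).trans (BddMeas.abs_integral_le hd2 ν)
  have h1 : ∀ x : Fin N → X, Complex.exp (Complex.I *
      ((t * (√(N : ℝ) * (sampleMean f x - m)) : ℝ) : ℂ)) =
      ∏ i, Complex.exp (Complex.I * ((u * (f (x i) - m) : ℝ) : ℂ)) := by
    intro x
    rw [sqrt_mul_sampleMean_sub hN, ← Complex.exp_sum,
      ← Finset.mul_sum (f := fun i => ((u * (f (x i) - m) : ℝ) : ℂ)),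
      Finset.mul_sum]
    push_cast
    congr 2
    refine Finset.sum_congr rfl fun i _ => ?_
    rw [hu]
    push_cast
    ring
  simp_rw [h1]
  rw [integral_fintype_prod_eq_pow
    (fun z => Complex.exp (Complex.I * ((u * (f z - m) : ℝ) : ℂ))), Fintype.card_fin]
  set ψ := ∫ z, Complex.exp (Complex.I * ((u * (f z - m) : ℝ) : ℂ)) ∂ν with hψ
  have h2 : Real.exp (-(t ^ 2 * v / 2)) = (Real.exp (-(u ^ 2 * v / 2))) ^ N := by
    rw [← Real.exp_nat_mul, ← hut]
    congr 1
    ring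
  rw [h2, Complex.ofReal_pow]
  have hψ1 : ‖ψ‖ ≤ 1 := norm_integral_cexp_I_mul_le_one _ ν
  have he1 : ‖((Real.exp (-(u ^ 2 * v / 2)) : ℝ) : ℂ)‖ ≤ 1 := by
    rw [Complex.norm_real, Real.norm_eq_abs, Real.abs_exp]
    exact Real.exp_le_one_iff.2 (by have : 0 ≤ u ^ 2 * v := by positivity
                                    linarith)
  refine (norm_pow_sub_pow_le hψ1 he1 N).trans ?_
  have hlin : BddMeas (fun z => f z - m) := hfb.sub (BddMeas.const m)
  have hpoly : ∫ z, ((1 : ℂ) + Complex.I * ((u * (f z - m) : ℝ) : ℂ) -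
      ((u * (f z - m) : ℝ) : ℂ) ^ 2 / 2) ∂ν = 1 - ((u ^ 2 * v / 2 : ℝ) : ℂ) := by
    have i1 : Integrable (fun z => ((u * (f z - m) : ℝ) : ℂ)) ν :=
      (((BddMeas.const u).mul hlin).integrable ν).ofReal
    have i2 : Integrable (fun z => (((u * (f z - m)) ^ 2 : ℝ) : ℂ)) ν :=
      ((((BddMeas.const u).mul hlin).pow 2).integrable ν).ofReal
    simp_rw [← Complex.ofReal_pow]
    have i0 : Integrable (fun z => (1 : ℂ) + Complex.I * ((u * (f z - m) : ℝ) : ℂ)) ν :=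
      (integrable_const _).add (i1.const_mul _)
    rw [integral_sub i0 (i2.div_const 2), integral_add (integrable_const _) (i1.const_mul _),
      integral_const_mul, integral_div,
      integral_complex_ofReal, integral_complex_ofReal, integral_const_mul,
      integral_sub (hfb.integrable ν) (integrable_const _)]
    simp_rw [mul_pow]
    rw [integral_const_mul]
    simp [← hm, ← hv]
  have h3 : ‖ψ - (1 - ((u ^ 2 * v / 2 : ℝ) : ℂ))‖ ≤ 4 * (|u| * (2 * C)) ^ 3 := by
    rw [← hpoly, hψ, ← integral_sub (integrable_cexp_I_mul (by fun_prop) ν)]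
    · refine (norm_integral_le_of_norm_le_const (C := 4 * (|u| * (2 * C)) ^ 3)
        (ae_of_all _ fun z => ?_)).trans (by simp)
      refine (norm_cexp_I_mul_taylor_two_le _).trans ?_
      rw [abs_mul]
      gcongr
      exact hd z
    · refine ((integrable_const _).add
        ((((BddMeas.const u).mul hlin).integrable ν).ofReal.const_mul _)).sub ?_
      simp_rw [← Complex.ofReal_pow]
      exact ((((BddMeas.const u).mul hlin).pow 2).integrable ν).ofReal.div_const 2
  have h4 : ‖(1 - ((u ^ 2 * v / 2 : ℝ) : ℂ)) - ((Real.exp (-(u ^ 2 * v / 2)) : ℝ) : ℂ)‖ ≤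
      (u ^ 2 * (2 * C) ^ 2 / 2) ^ 2 := by
    rw [← Complex.ofReal_one, ← Complex.ofReal_sub, ← Complex.ofReal_sub, Complex.norm_real,
      Real.norm_eq_abs, abs_sub_comm]
    refine (abs_exp_neg_sub_one_sub_le (by positivity)).trans ?_
    gcongr
  have h5 : ‖ψ - ((Real.exp (-(u ^ 2 * v / 2)) : ℝ) : ℂ)‖ ≤
      4 * (|u| * (2 * C)) ^ 3 + (u ^ 2 * (2 * C) ^ 2 / 2) ^ 2 := by
    refine (norm_sub_le_norm_sub_add_norm_sub _ (1 - ((u ^ 2 * v / 2 : ℝ) : ℂ)) _).trans ?_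
    exact add_le_add h3 h4
  have hua : |u| = |t| / √N := by rw [hu, abs_div, abs_of_pos hsp]
  have hu2 : u ^ 2 = t ^ 2 / N := by rw [hu, div_pow, hs]
  calc (N : ℝ) * ‖ψ - ((Real.exp (-(u ^ 2 * v / 2)) : ℝ) : ℂ)‖
      ≤ N * (4 * (|u| * (2 * C)) ^ 3 + (u ^ 2 * (2 * C) ^ 2 / 2) ^ 2) := by gcongr
    _ = 32 * |t| ^ 3 * C ^ 3 / √N + 4 * t ^ 4 * C ^ 4 / N := by
      rw [hua, hu2]
      generalize √(N : ℝ) = r at hsp hs ⊢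
      rw [← hs]
      field_simp
      ring
    -- Here √N ≤ N, because N ≥ 1.
    _ ≤ 32 * |t| ^ 3 * C ^ 3 / √N + 4 * t ^ 4 * C ^ 4 / √N := by
      gcongr
      nlinarith
    _ = _ := by ring

end IID

/-! ### Absolute moments of Gaussian limits -/

/-- The integrand is even, so the integral reduces to a Gamma integral on the half-line. A
degenerate Gaussian gives 0 on both sides because p > 0. -/
lemma integral_abs_rpow_gaussianReal (v : NNReal) {p : ℝ} (hp : 0 < p) :
    ∫ x, |x| ^ p ∂(gaussianReal 0 v) =
      (2 * v) ^ (p / 2) * (Real.Gamma ((p + 1) / 2) / √Real.pi) := by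
  rcases eq_or_ne v 0 with rfl | hv
  · simp [gaussianReal_zero_var, Real.zero_rpow hp.ne', Real.zero_rpow (half_pos hp).ne']
  have hv0 : (0 : ℝ) < v := by
    have := pos_iff_ne_zero.2 hv
    exact_mod_cast this
  rw [integral_gaussianReal_eq_integral_smul hv]
  have h1 : ∀ x : ℝ, gaussianPDFReal 0 v x • |x| ^ p =
      (fun r : ℝ => (√(2 * Real.pi * v))⁻¹ *
        (r ^ p * Real.exp (-(1 / (2 * v)) * r ^ (2 : ℝ)))) |x| := by
    intro x
    simp only [gaussianPDFReal, smul_eq_mul, sub_zero]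
    rw [Real.rpow_two, sq_abs]
    have : -x ^ 2 / (2 * v) = -(1 / (2 * v)) * x ^ 2 := by ring
    rw [this]
    ring
  simp_rw [h1]
  rw [integral_comp_abs (f := fun r : ℝ =>
    (√(2 * Real.pi * v))⁻¹ * (r ^ p * Real.exp (-(1 / (2 * v)) * r ^ (2 : ℝ))))]
  rw [integral_const_mul, integral_rpow_mul_exp_neg_mul_rpow two_pos (by linarith) (by positivity)]
  have h2 : (1 / (2 * (v : ℝ))) ^ (-(p + 1) / 2) = (2 * v) ^ (p / 2) * √(2 * v) := by
    rw [one_div, Real.inv_rpow (by positivity), ← Real.rpow_neg (by positivity),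
      Real.sqrt_eq_rpow, ← Real.rpow_add (by positivity)]
    congr 1
    ring
  have h3 : √(2 * Real.pi * v) = √(2 * v) * √Real.pi := by
    rw [← Real.sqrt_mul (by positivity)]
    congr 1
    ring
  rw [h2, h3]
  have h4 : √(2 * (v : ℝ)) ≠ 0 := by positivity
  have h5 : √Real.pi ≠ 0 := by positivity
  field_simp

/-- Truncation matters only where |x|^p ≥ R, and there |x|^p ≤ |x|^(2p)/R, which the exponential
moment controls. -/
lemma abs_integral_rpow_sub_integral_min_le {ρ : Measure ℝ} [IsProbabilityMeasure ρ] {p K R : ℝ}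
    (hp : 0 < p) (hR : 0 < R) (hK : ∀ r, 0 ≤ r → r ^ (2 * p) ≤ K * Real.exp r)
    (hexpI : Integrable (fun x => Real.exp |x|) ρ) :
    |∫ x, |x| ^ p ∂ρ - ∫ x, min (|x| ^ p) R ∂ρ| ≤ K * (∫ x, Real.exp |x| ∂ρ) / R := by
  obtain ⟨L, hL0, hL⟩ := exists_rpow_le_mul_exp hp.le
  have hc : Continuous fun x : ℝ => |x| ^ p := continuous_abs.rpow_const fun _ => Or.inr hp.le
  have i1 : Integrable (fun x : ℝ => |x| ^ p) ρ := by
    refine (hexpI.const_mul L).mono' hc.aestronglyMeasurable (ae_of_all _ fun x => ?_)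
    rw [Real.norm_eq_abs, abs_of_nonneg (by positivity)]
    exact hL _ (abs_nonneg x)
  have i2 : Integrable (fun x : ℝ => min (|x| ^ p) R) ρ := i1.inf (integrable_const R)
  rw [← Real.norm_eq_abs, ← integral_sub i1 i2, ← integral_const_mul, ← integral_div]
  refine (norm_integral_le_of_norm_le ((hexpI.const_mul K).div_const R) (ae_of_all _ fun x => ?_))
  have h0 : 0 ≤ |x| ^ p := by positivity
  have h2p : (|x| ^ p) ^ 2 = |x| ^ (2 * p) := by
    rw [← Real.rpow_natCast, ← Real.rpow_mul (abs_nonneg x)]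
    congr 1
    push_cast
    ring
  have h1 := hK |x| (abs_nonneg x)
  rw [← h2p] at h1
  rw [Real.norm_eq_abs, le_div_iff₀ hR]
  rcases le_total (|x| ^ p) R with h | h
  · rw [min_eq_left h]
    simp only [sub_self, abs_zero, zero_mul]
    exact (sq_nonneg _).trans h1
  · rw [min_eq_right h, abs_of_nonneg (by linarith)]
    nlinarith

/-- Convergence of characteristic functions together with a uniform bound on an exponential moment
gives convergence of absolute moments. -/
lemma tendsto_integral_abs_rpow_of_tendsto_charFun {ρ : ℕ → Measure ℝ} {ρ₀ : Measure ℝ}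
    [∀ N, IsProbabilityMeasure (ρ N)] [IsProbabilityMeasure ρ₀]
    (hcf : ∀ t, Tendsto (fun N => charFun (ρ N) t) atTop (𝓝 (charFun ρ₀ t)))
    (hexpI : ∀ N, Integrable (fun x => Real.exp |x|) (ρ N))
    (hexpI₀ : Integrable (fun x => Real.exp |x|) ρ₀)
    {C : ℝ} (hC : ∀ N, ∫ x, Real.exp |x| ∂(ρ N) ≤ C) {p : ℝ} (hp : 0 < p) :
    Tendsto (fun N => ∫ x, |x| ^ p ∂(ρ N)) atTop (𝓝 (∫ x, |x| ^ p ∂ρ₀)) := by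
  obtain ⟨K, hK0, hK⟩ := exists_rpow_le_mul_exp (q := 2 * p) (by positivity)
  have hweak := ProbabilityMeasure.tendsto_of_tendsto_charFun
    (μ := fun N => (⟨ρ N, inferInstance⟩ : ProbabilityMeasure ℝ)) (μ₀ := ⟨ρ₀, inferInstance⟩) hcf
  have hmin : ∀ R : ℝ, 0 < R → Tendsto (fun N => ∫ x, min (|x| ^ p) R ∂(ρ N)) atTop
      (𝓝 (∫ x, min (|x| ^ p) R ∂ρ₀)) := by
    intro R hR
    have hc : Continuous fun x : ℝ => min (|x| ^ p) R :=
      (continuous_abs.rpow_const fun _ => Or.inr hp.le).min continuous_const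
    exact ProbabilityMeasure.tendsto_iff_forall_integral_tendsto.1 hweak
      (BoundedContinuousFunction.ofNormedAddCommGroup _ hc R fun x => by
      rw [Real.norm_eq_abs, abs_of_nonneg (le_min (by positivity) hR.le)]
      exact min_le_right _ _)
  set C' := max C (∫ x, Real.exp |x| ∂ρ₀) with hC'
  have hC'0 : 0 ≤ C' := (integral_nonneg fun x => (Real.exp_pos _).le).trans (le_max_right _ _)
  rw [Metric.tendsto_atTop]
  intro ε hε
  -- The level R makes both truncation errors, for ρ N and for ρ₀, smaller than ε/3; the summand 1
  -- keeps R positive when K * C' = 0.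
  set R := 3 * (K * C' + 1) / ε with hR
  have hR0 : 0 < R := by positivity
  obtain ⟨N₀, hN₀⟩ := Metric.tendsto_atTop.1 (hmin R hR0) (ε / 3) (by positivity)
  have hbound : K * C' / R < ε / 3 := by
    rw [div_lt_iff₀ hR0, hR]
    field_simp
    linarith
  refine ⟨N₀, fun N hN => ?_⟩
  have h1 := abs_integral_rpow_sub_integral_min_le hp hR0 hK (hexpI N)
  have h2 := abs_integral_rpow_sub_integral_min_le hp hR0 hK hexpI₀
  have h3 := hN₀ N hN
  have h1' : K * (∫ x, Real.exp |x| ∂(ρ N)) / R ≤ K * C' / R := by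
    gcongr
    exact (hC N).trans (le_max_left _ _)
  have h2' : K * (∫ x, Real.exp |x| ∂ρ₀) / R ≤ K * C' / R := by
    gcongr
    exact le_max_right _ _
  rw [Real.dist_eq] at h3 ⊢
  rw [abs_lt] at h3 ⊢
  rw [abs_le] at h1 h2
  constructor <;> linarith [h1.1, h1.2, h2.1, h2.2, h3.1, h3.2]

lemma integrable_exp_abs_gaussianReal (v : NNReal) :
    Integrable (fun x => Real.exp |x|) (gaussianReal 0 v) := by
  have h1 := integrable_exp_mul_gaussianReal (μ := 0) (v := v) 1
  have h2 := integrable_exp_mul_gaussianReal (μ := 0) (v := v) (-1)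
  refine (h1.add h2).mono' (by fun_prop) (ae_of_all _ fun x => ?_)
  simpa using exp_abs_le x

/-- Absolute moments of random variables whose characteristic functions converge to a centered
Gaussian one and whose exponential moments are bounded. -/
lemma tendsto_integral_abs_rpow_gaussian {α : ℕ → Type*} [∀ N, MeasurableSpace (α N)]
    {μ : ∀ N, Measure (α N)} [∀ N, IsProbabilityMeasure (μ N)] {W : ∀ N, α N → ℝ}
    (hW : ∀ N, BddMeas (W N)) {v : ℝ} (hv : 0 ≤ v)
    (hcf : ∀ t : ℝ, Tendsto
      (fun N => ∫ x, Complex.exp (Complex.I * ((t * W N x : ℝ) : ℂ)) ∂(μ N)) atTop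
      (𝓝 ((Real.exp (-(t ^ 2 * v / 2)) : ℝ) : ℂ)))
    {C : ℝ} (hC : ∀ N, ∫ x, Real.exp |W N x| ∂(μ N) ≤ C) {p : ℝ} (hp : 0 < p) :
    Tendsto (fun N => ∫ x, |W N x| ^ p ∂(μ N)) atTop
      (𝓝 ((2 * v) ^ (p / 2) * (Real.Gamma ((p + 1) / 2) / √Real.pi))) := by
  lift v to NNReal using hv
  rw [← integral_abs_rpow_gaussianReal v hp]
  have hm : ∀ N, AEMeasurable (W N) (μ N) := fun N => (hW N).1.aemeasurable
  have hprob : ∀ N, IsProbabilityMeasure ((μ N).map (W N)) := fun N =>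
    Measure.isProbabilityMeasure_map (hm N)
  have hmeas : Measurable fun x : ℝ => Real.exp |x| := by fun_prop
  -- The variables live on different spaces, so their laws on ℝ are compared instead.
  have key := tendsto_integral_abs_rpow_of_tendsto_charFun (ρ := fun N => (μ N).map (W N))
    (ρ₀ := gaussianReal 0 v) (C := C) ?_ ?_ (integrable_exp_abs_gaussianReal v) ?_ hp
  · refine key.congr fun N => ?_
    rw [integral_map (hm N)]
    exact ((continuous_abs.rpow_const fun _ => Or.inr hp.le).measurable).aestronglyMeasurable
  · intro t
    rw [charFun_gaussianReal]
    have h1 : Complex.exp (t * (0 : ℝ) * Complex.I - v * t ^ 2 / 2) =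
        ((Real.exp (-(t ^ 2 * v / 2)) : ℝ) : ℂ) := by
      push_cast
      congr 1
      ring
    rw [h1]
    refine (hcf t).congr fun N => ?_
    rw [charFun_apply_real, integral_map (hm N) (by fun_prop)]
    refine integral_congr_ae (ae_of_all _ fun x => ?_)
    push_cast
    ring_nf
  · intro N
    rw [integrable_map_measure hmeas.aestronglyMeasurable (hm N)]
    exact ((hW N).abs.exp).integrable _
  · intro N
    rw [integral_map (hm N) hmeas.aestronglyMeasurable]
    exact hC N

lemma BddMeas.integral_pos {α : Type*} [MeasurableSpace α] {f : α → ℝ} (hf : BddMeas f)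
    (hpos : ∀ x, 0 < f x) (μ : Measure α) [IsProbabilityMeasure μ] : 0 < ∫ x, f x ∂μ := by
  rw [integral_pos_iff_support_of_nonneg (fun x => (hpos x).le) (hf.integrable μ)]
  have : Function.support f = Set.univ := by
    ext x
    simp [(hpos x).ne']
  simp [this]

lemma integral_bind_kernel {α β E : Type*} [MeasurableSpace α] [MeasurableSpace β]
    [NormedAddCommGroup E] [NormedSpace ℝ E] {μ : Measure α} {κ : Kernel α β} {f : β → E}
    (hf : Integrable f (μ.bind κ)) : ∫ z, f z ∂(μ.bind κ) = ∫ x, ∫ z, f z ∂(κ x) ∂μ := by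
  have h : (κ ∘ₖ Kernel.const Unit μ) () = μ.bind κ := by
    rw [Kernel.comp_apply, Kernel.const_apply]
  rw [← h] at hf ⊢
  rw [Kernel.integral_comp hf, Kernel.const_apply]

namespace HiddenMarkovModel

variable {X Y : Type*} [MeasurableSpace X] [MeasurableSpace Y] (M : HiddenMarkovModel X Y)

lemma measurable_g_left (y : Y) : Measurable fun x => M.g x y :=
  M.measurable_g.comp (measurable_id.prodMk measurable_const)

/-! ### The updating step -/

lemma toReal_lintegral_g (y : Y) (μ : Measure X) :
    (∫⁻ x, ENNReal.ofReal (M.g x y) ∂μ).toReal = ∫ x, M.g x y ∂μ :=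
  (integral_eq_lintegral_of_nonneg_ae (ae_of_all _ fun x => M.g_nonneg x y)
    (M.measurable_g_left y).aestronglyMeasurable).symm

/-- No hypothesis on μ is needed: if the normalizing mass is 0 or ∞, both sides are 0 by the
conventions for inverses and for non-integrable functions. -/
lemma integral_update (y : Y) (μ : Measure X) (f : X → ℝ) :
    ∫ x, f x ∂(M.update y μ) = (∫ x, M.g x y * f x ∂μ) / ∫ x, M.g x y ∂μ := by
  rw [update, integral_smul_measure, ENNReal.toReal_inv, toReal_lintegral_g,
    integral_withDensity_eq_integral_toReal_smul (M.measurable_g_left y).ennreal_ofReal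
      (ae_of_all _ fun x => ENNReal.ofReal_lt_top)]
  simp only [ENNReal.toReal_ofReal (M.g_nonneg _ _), smul_eq_mul]
  rw [div_eq_inv_mul]

lemma lintegral_g_ne_zero {y : Y} (hpos : ∀ x, 0 < M.g x y) (μ : Measure X)
    [IsProbabilityMeasure μ] : ∫⁻ x, ENNReal.ofReal (M.g x y) ∂μ ≠ 0 := by
  rw [ne_eq, lintegral_eq_zero_iff (M.measurable_g_left y).ennreal_ofReal]
  intro h
  obtain ⟨x, hx⟩ := h.exists
  simp at hx
  exact absurd (hpos x) (not_lt.2 hx)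

lemma isProbabilityMeasure_update {y : Y} {μ : Measure X}
    (h0 : ∫⁻ x, ENNReal.ofReal (M.g x y) ∂μ ≠ 0) (h1 : ∫⁻ x, ENNReal.ofReal (M.g x y) ∂μ ≠ ∞) :
    IsProbabilityMeasure (M.update y μ) := by
  constructor
  rw [update, Measure.smul_apply, withDensity_apply _ MeasurableSet.univ, Measure.restrict_univ,
    smul_eq_mul, ENNReal.inv_mul_cancel h0 h1]

lemma isProbabilityMeasure_update_of_integrable {y : Y} (hpos : ∀ x, 0 < M.g x y) {μ : Measure X}
    [IsProbabilityMeasure μ] (hg : Integrable (fun x => M.g x y) μ) :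
    IsProbabilityMeasure (M.update y μ) :=
  M.isProbabilityMeasure_update (M.lintegral_g_ne_zero hpos μ) hg.lintegral_lt_top.ne

lemma integral_feynmanKac (y : Y) (μ : Measure X) [IsProbabilityMeasure (M.update y μ)]
    {f : X → ℝ} (hf : BddMeas f) :
    ∫ x, f x ∂(M.feynmanKac y μ) = ∫ x, (∫ x', f x' ∂(M.Q x)) ∂(M.update y μ) :=
  integral_bind_kernel (hf.integrable _)

lemma isProbabilityMeasure_feynmanKac (y : Y) (μ : Measure X)
    [IsProbabilityMeasure (M.update y μ)] :
    IsProbabilityMeasure (M.feynmanKac y μ) := by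
  unfold feynmanKac
  infer_instance

/-! ### The unnormalized kernels and the predictor -/

lemma stepKernel_apply (y : Y) (x : X) :
    M.stepKernel y x = ENNReal.ofReal (M.g x y) • M.Q x := by
  have hm : Measurable (Function.uncurry fun (x _ : X) => ENNReal.ofReal (M.g x y)) :=
    (M.measurable_g_left y).ennreal_ofReal.comp measurable_fst
  rw [stepKernel, Kernel.withDensity_apply _ hm, withDensity_const]

lemma integral_stepKernel (y : Y) (x : X) (f : X → ℝ) :
    ∫ x', f x' ∂(M.stepKernel y x) = M.g x y * ∫ x', f x' ∂(M.Q x) := by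
  rw [stepKernel_apply, integral_smul_measure, ENNReal.toReal_ofReal (M.g_nonneg _ _), smul_eq_mul]

lemma isFiniteKernel_stepKernel {y : Y} (hb : BddMeas fun x => M.g x y) :
    IsFiniteKernel (M.stepKernel y) := by
  obtain ⟨C, hC0, hC⟩ := hb.exists_nonneg_bound
  refine ⟨ENNReal.ofReal C, ENNReal.ofReal_lt_top, fun x => ?_⟩
  rw [stepKernel_apply, Measure.smul_apply, measure_univ, smul_eq_mul, mul_one]
  exact ENNReal.ofReal_le_ofReal ((le_abs_self _).trans (hC x))

lemma lkh_self (y : ℕ → Y) (k : ℕ) : M.lkh y k k = Kernel.id := by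
  cases k <;> simp [lkh]

lemma lkh_succ (y : ℕ → Y) {k n : ℕ} (h : k ≤ n) :
    M.lkh y k (n + 1) = M.stepKernel (y n) ∘ₖ M.lkh y k n := by
  simp [lkh, h]

variable {y : ℕ → Y}

lemma isFiniteKernel_lkh (hb : ∀ k, BddMeas fun x => M.g x (y k)) (k n : ℕ) :
    IsFiniteKernel (M.lkh y k n) := by
  induction n with
  | zero => simp only [lkh]; infer_instance
  | succ n ih =>
    have := M.isFiniteKernel_stepKernel (hb n)
    simp only [lkh]
    split_ifs <;> infer_instance

lemma lkhFun_self (k : ℕ) {f : X → ℝ} (hf : Measurable f) : M.lkhFun y k k f = f := by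
  ext x
  rw [lkhFun, lkh_self, Kernel.id_apply, integral_dirac' _ _ hf.stronglyMeasurable]

/-- The function `x ↦ g(x, y) ∫ f(x') Q(x, dx')`. -/
def weightedQ (y : Y) (f : X → ℝ) (x : X) : ℝ := M.g x y * ∫ x', f x' ∂(M.Q x)

lemma bddMeas_weightedQ {y : Y} (hb : BddMeas fun x => M.g x y) {f : X → ℝ} (hf : BddMeas f) :
    BddMeas (M.weightedQ y f) := hb.mul (hf.kernel_integral M.Q)

/-- Peeling off the last observation leaves k fixed, so later inductions run over n with the test
function generalized. -/
lemma lkhFun_succ (hb : ∀ k, BddMeas fun x => M.g x (y k)) {k n : ℕ} (h : k ≤ n)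
    {f : X → ℝ} (hf : BddMeas f) :
    M.lkhFun y k (n + 1) f = M.lkhFun y k n (M.weightedQ (y n) f) := by
  ext x
  have h1 := M.isFiniteKernel_stepKernel (hb n)
  have h2 := M.isFiniteKernel_lkh hb k n
  rw [lkhFun, lkh_succ M y h, Kernel.integral_comp (hf.integrable _)]
  simp only [integral_stepKernel]
  rfl

lemma weightedQ_one (y : Y) : M.weightedQ y (fun _ => 1) = fun x => M.g x y := by
  ext x
  simp [weightedQ]

lemma bddMeas_lkhFun (hb : ∀ k, BddMeas fun x => M.g x (y k)) {k n : ℕ} (h : k ≤ n)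
    {f : X → ℝ} (hf : BddMeas f) : BddMeas (M.lkhFun y k n f) := by
  induction n, h using Nat.le_induction generalizing f with
  | base => rwa [lkhFun_self M k hf.1]
  | succ n hn ih =>
    rw [lkhFun_succ M hb hn hf]
    exact ih (M.bddMeas_weightedQ (hb n) hf)

lemma lkhFun_pos (hpos : ∀ x y, 0 < M.g x y) (hb : ∀ k, BddMeas fun x => M.g x (y k)) {k n : ℕ}
    (h : k ≤ n) {f : X → ℝ} (hf : BddMeas f) (hf0 : ∀ x, 0 < f x) (x : X) :
    0 < M.lkhFun y k n f x := by
  induction n, h using Nat.le_induction generalizing f with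
  | base => rw [lkhFun_self M k hf.1]; exact hf0 x
  | succ n hn ih =>
    rw [lkhFun_succ M hb hn hf]
    exact ih (M.bddMeas_weightedQ (hb n) hf)
      fun x => mul_pos (hpos _ _) (hf.integral_pos hf0 _)

lemma lkhFun_sub_const_mul (hb : ∀ k, BddMeas fun x => M.g x (y k)) (k n : ℕ) {f f' : X → ℝ}
    (hf : BddMeas f) (hf' : BddMeas f') (c : ℝ) (x : X) :
    M.lkhFun y k n f x - c * M.lkhFun y k n f' x = M.lkhFun y k n (fun x => f x - c * f' x) x := by
  have := M.isFiniteKernel_lkh hb k n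
  simp only [lkhFun]
  rw [integral_sub (hf.integrable _) ((hf'.integrable _).const_mul c), integral_const_mul]

variable (χ : Measure X) [IsProbabilityMeasure χ]

lemma integral_bind_lkh (hb : ∀ k, BddMeas fun x => M.g x (y k)) (n : ℕ) {f : X → ℝ}
    (hf : BddMeas f) :
    ∫ x, f x ∂(χ.bind (M.lkh y 0 n)) = ∫ x, M.lkhFun y 0 n f x ∂χ := by
  have := M.isFiniteKernel_lkh hb 0 n
  exact integral_bind_kernel (hf.integrable _)

lemma isProbabilityMeasure_pred (hpos : ∀ x y, 0 < M.g x y)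
    (hb : ∀ k, BddMeas fun x => M.g x (y k)) (n : ℕ) : IsProbabilityMeasure (M.pred χ y n) := by
  have := M.isFiniteKernel_lkh hb 0 n
  have h1 := M.integral_bind_lkh χ hb n (BddMeas.const 1)
  have h2 := (M.bddMeas_lkhFun hb (Nat.zero_le n) (BddMeas.const 1)).integral_pos
    (M.lkhFun_pos hpos hb (Nat.zero_le n) (BddMeas.const 1) fun _ => one_pos) χ
  rw [← h1, integral_const, smul_eq_mul, mul_one] at h2
  constructor
  rw [pred, Measure.smul_apply, smul_eq_mul, ENNReal.inv_mul_cancel]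
  · intro h
    simp [Measure.real, h] at h2
  · exact measure_ne_top _ _

lemma integral_pred (hb : ∀ k, BddMeas fun x => M.g x (y k)) (n : ℕ) {f : X → ℝ} (hf : BddMeas f) :
    ∫ x, f x ∂(M.pred χ y n) =
      (∫ x, M.lkhFun y 0 n f x ∂χ) / ∫ x, M.lkhFun y 0 n (fun _ => 1) x ∂χ := by
  rw [pred, integral_smul_measure, ENNReal.toReal_inv, integral_bind_lkh M χ hb n hf,
    ← integral_bind_lkh M χ hb n (BddMeas.const 1), integral_const, smul_eq_mul, smul_eq_mul,
    mul_one, div_eq_inv_mul]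
  rfl

lemma integral_pred_zero (hb : ∀ k, BddMeas fun x => M.g x (y k)) {f : X → ℝ} (hf : BddMeas f) :
    ∫ x, f x ∂(M.pred χ y 0) = ∫ x, f x ∂χ := by
  rw [integral_pred M χ hb 0 hf, lkhFun_self M 0 hf.1, lkhFun_self M 0 measurable_const]
  simp

lemma integral_pred_succ (hpos : ∀ x y, 0 < M.g x y) (hb : ∀ k, BddMeas fun x => M.g x (y k))
    (n : ℕ) {f : X → ℝ} (hf : BddMeas f) :
    ∫ x, f x ∂(M.pred χ y (n + 1)) =
      (∫ x, M.weightedQ (y n) f x ∂(M.pred χ y n)) / ∫ x, M.g x (y n) ∂(M.pred χ y n) := by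
  rw [integral_pred M χ hb _ hf, integral_pred M χ hb _ (M.bddMeas_weightedQ (hb n) hf),
    integral_pred M χ hb _ (hb n), lkhFun_succ M hb (Nat.zero_le n) hf,
    lkhFun_succ M hb (Nat.zero_le n) (BddMeas.const 1), weightedQ_one]
  have h2 := (M.bddMeas_lkhFun hb (Nat.zero_le n) (BddMeas.const 1)).integral_pos
    (M.lkhFun_pos hpos hb (Nat.zero_le n) (BddMeas.const 1) fun _ => one_pos) χ
  rw [div_div_div_cancel_right₀ h2.ne']

/-- The flow property: transporting the predictor from time k to time n gives the later predictor up
to its mass. In the variance recursion it factors the normalizing constants. -/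
lemma integral_lkhFun_pred (hpos : ∀ x y, 0 < M.g x y) (hb : ∀ k, BddMeas fun x => M.g x (y k))
    {k n : ℕ} (h : k ≤ n) {f : X → ℝ} (hf : BddMeas f) :
    ∫ x, M.lkhFun y k n f x ∂(M.pred χ y k) =
      (∫ x, M.lkhFun y k n (fun _ => 1) x ∂(M.pred χ y k)) * ∫ x, f x ∂(M.pred χ y n) := by
  induction n, h using Nat.le_induction generalizing f with
  | base =>
    have := M.isProbabilityMeasure_pred χ hpos hb k
    rw [lkhFun_self M k hf.1, lkhFun_self M k measurable_const]
    simp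
  | succ n hn ih =>
    have := M.isProbabilityMeasure_pred χ hpos hb n
    have hg := (hb n).integral_pos (fun x => hpos x (y n)) (M.pred χ y n)
    rw [lkhFun_succ M hb hn hf, lkhFun_succ M hb hn (BddMeas.const 1),
      ih (M.bddMeas_weightedQ (hb n) hf), weightedQ_one, ih (hb n),
      integral_pred_succ M χ hpos hb n hf]
    field_simp

/-! ### Recursion for the asymptotic variance -/

lemma predVariance_zero (hb : ∀ k, BddMeas fun x => M.g x (y k)) {f : X → ℝ} (hf : BddMeas f) :
    M.predVariance χ y 0 f = ∫ x, (f x - ∫ x', f x' ∂χ) ^ 2 ∂χ := by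
  simp only [predVariance, zero_add, Finset.sum_range_one]
  rw [lkhFun_self M 0 hf.1, lkhFun_self M 0 measurable_const, integral_pred_zero M χ hb hf,
    integral_pred_zero M χ hb (BddMeas.const 1)]
  rw [integral_pred_zero M χ hb]
  · simp
  · exact ((hf.sub ((BddMeas.const _).mul (BddMeas.const _))).div_const _).pow 2

/-- Because of this, the centering term inside the time-n variance in `predVariance_succ` vanishes.
-/
lemma integral_weighted_centered (hpos : ∀ x y, 0 < M.g x y)
    (hb : ∀ k, BddMeas fun x => M.g x (y k)) (n : ℕ) {f : X → ℝ} (hf : BddMeas f) :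
    ∫ x, M.g x (y n) * ((∫ x', f x' ∂(M.Q x)) - ∫ x', f x' ∂(M.pred χ y (n + 1)))
      ∂(M.pred χ y n) = 0 := by
  have := M.isProbabilityMeasure_pred χ hpos hb n
  have hg := (hb n).integral_pos (fun x => hpos x (y n)) (M.pred χ y n)
  simp_rw [mul_sub]
  change ∫ x, (M.weightedQ (y n) f x - M.g x (y n) * _) ∂_ = 0
  rw [integral_sub ((M.bddMeas_weightedQ (hb n) hf).integrable _)
    (((hb n).integrable _).mul_const _), integral_mul_const, integral_pred_succ M χ hpos hb n hf,
    mul_div_cancel₀ _ hg.ne', sub_self]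

/-- The summand k = n + 1 is the fresh sampling noise. In each earlier summand the last observation
is peeled off: the numerator becomes L applied to g(Qf - φf), and the denominator gains the factor
φ_n g, independent of k. -/
lemma predVariance_succ (hpos : ∀ x y, 0 < M.g x y) (hb : ∀ k, BddMeas fun x => M.g x (y k))
    (n : ℕ) {f : X → ℝ} (hf : BddMeas f) :
    M.predVariance χ y (n + 1) f =
      (∫ x, (f x - ∫ x', f x' ∂(M.pred χ y (n + 1))) ^ 2 ∂(M.pred χ y (n + 1))) +
      M.predVariance χ y n (fun x => M.g x (y n) *
        ((∫ x', f x' ∂(M.Q x)) - ∫ x', f x' ∂(M.pred χ y (n + 1)))) /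
        (∫ x, M.g x (y n) ∂(M.pred χ y n)) ^ 2 := by
  have hp1 := M.isProbabilityMeasure_pred χ hpos hb (n + 1)
  have h0 := M.integral_weighted_centered χ hpos hb n hf
  rw [predVariance, Finset.sum_range_succ, add_comm]
  congr 1
  · rw [lkhFun_self M _ hf.1, lkhFun_self M _ measurable_const]
    simp
  · rw [predVariance, Finset.sum_div, h0]
    refine Finset.sum_congr rfl fun k hk => ?_
    have hk' : k ≤ n := Nat.lt_succ_iff.1 (Finset.mem_range.1 hk)
    rw [← integral_div]
    refine integral_congr_ae (ae_of_all _ fun x => ?_)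
    simp only
    rw [lkhFun_sub_const_mul M hb _ _ hf (BddMeas.const 1), zero_mul, sub_zero, div_pow, div_pow,
      div_div, ← mul_pow]
    congr 2
    · rw [lkhFun_succ M hb hk' (hf.sub ((BddMeas.const _).mul (BddMeas.const _)))]
      congr 1
      ext z
      simp only [weightedQ, mul_one]
      rw [integral_sub (hf.integrable _) (integrable_const _)]
      simp
    · rw [lkhFun_succ M hb hk' (BddMeas.const 1), weightedQ_one,
        integral_lkhFun_pred M χ hpos hb hk' (hb n)]

lemma predVariance_nonneg {y : ℕ → Y} (χ : Measure X) (n : ℕ) (f : X → ℝ) :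
    0 ≤ M.predVariance χ y n f :=
  Finset.sum_nonneg fun _ _ => integral_nonneg fun _ => sq_nonneg _

end HiddenMarkovModel

/-! ### Linearization of a ratio -/

/-- From A/B = A/b + (A/B)(b - B)/b, with the a priori bound |A/B| ≤ D in the last term. Only b
enters the denominators, so B may be arbitrarily small. -/
lemma abs_div_le_of_abs_le_mul {A B b D : ℝ} (hb : 0 < b) (hB : 0 < B) (hA : |A| ≤ D * B) :
    |A / B| ≤ |A| / b + D * |B - b| / b := by
  have h1 : A / B = A / b + (A / B) * ((b - B) / b) := by field_simp; ring
  have h2 : |A / B| ≤ D := by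
    rw [abs_div, abs_of_pos hB]
    exact (div_le_iff₀ hB).2 hA
  have h3 : |(b - B) / b| = |B - b| / b := by rw [abs_div, abs_of_pos hb, abs_sub_comm]
  calc |A / B| = |A / b + (A / B) * ((b - B) / b)| := by rw [← h1]
    _ ≤ |A / b| + |A / B| * |(b - B) / b| := (abs_add_le _ _).trans (by rw [abs_mul])
    _ ≤ |A| / b + D * (|B - b| / b) := by
      rw [h3, abs_div A b, abs_of_pos hb]
      gcongr
    _ = _ := by ring

/-- The same identity, with the preceding bound inserted for A/B, makes the error quadratic in the
deviations. -/
lemma abs_div_sub_div_le_of_abs_le_mul {A B b D : ℝ} (hb : 0 < b) (hB : 0 < B)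
    (hA : |A| ≤ D * B) :
    |A / B - A / b| ≤ (|A| * |B - b| + D * |B - b| ^ 2) / b ^ 2 := by
  have h1 : A / B - A / b = (A / B) * ((b - B) / b) := by field_simp
  have h3 : |(b - B) / b| = |B - b| / b := by rw [abs_div, abs_of_pos hb, abs_sub_comm]
  rw [h1, abs_mul, h3]
  calc _ ≤ (|A| / b + D * |B - b| / b) * (|B - b| / b) := by
        gcongr
        exact abs_div_le_of_abs_le_mul hb hB hA
    _ = _ := by field_simp

namespace HiddenMarkovModel

variable {X Y : Type*} [MeasurableSpace X] [MeasurableSpace Y] (M : HiddenMarkovModel X Y)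

/-! ### Empirical measures -/

lemma lintegral_empirical {N : ℕ} (x : Fin N → X) {f : X → ℝ≥0∞} (hf : Measurable f) :
    ∫⁻ z, f z ∂(empirical x) = (N : ℝ≥0∞)⁻¹ * ∑ i, f (x i) := by
  rw [empirical, lintegral_smul_measure, lintegral_finsetSum_measure, smul_eq_mul]
  simp_rw [lintegral_dirac' _ hf]

lemma isProbabilityMeasure_empirical {N : ℕ} (hN : 0 < N) (x : Fin N → X) :
    IsProbabilityMeasure (empirical x) := by
  constructor
  rw [← lintegral_one, lintegral_empirical x measurable_const]
  simp only [Finset.sum_const, Finset.card_univ, Fintype.card_fin, nsmul_eq_mul, mul_one]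
  exact ENNReal.inv_mul_cancel (by exact_mod_cast hN.ne') (ENNReal.natCast_ne_top N)

lemma integral_empirical {N : ℕ} (x : Fin N → X) {f : X → ℝ} (hf : Measurable f) :
    ∫ z, f z ∂(empirical x) = sampleMean f x := by
  rw [empirical, integral_smul_measure, integral_finsetSum_measure]
  · simp_rw [integral_dirac' _ _ hf.stronglyMeasurable]
    simp [sampleMean, div_eq_inv_mul]
  · intro i _
    exact integrable_dirac' hf.stronglyMeasurable (by simp)

/-- A finite sum of finite weights is finite, so boundedness of g plays no role and the particle
kernels exist for every observation sequence, including the exceptional ones. -/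
lemma isProbabilityMeasure_update_empirical (hpos : ∀ x y, 0 < M.g x y) {N : ℕ} (hN : 0 < N)
    (y : Y) (x : Fin N → X) : IsProbabilityMeasure (M.update y (empirical x)) := by
  have := isProbabilityMeasure_empirical hN x
  refine M.isProbabilityMeasure_update (M.lintegral_g_ne_zero (fun z => hpos z y) _) ?_
  rw [lintegral_empirical x (M.measurable_g_left y).ennreal_ofReal]
  refine ENNReal.mul_ne_top (ENNReal.inv_ne_top.2 (by exact_mod_cast hN.ne')) ?_
  exact (ENNReal.sum_lt_top.2 fun i _ => ENNReal.ofReal_lt_top).ne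

lemma isProbabilityMeasure_feynmanKac_empirical (hpos : ∀ x y, 0 < M.g x y) {N : ℕ} (hN : 0 < N)
    (y : Y) (x : Fin N → X) : IsProbabilityMeasure (M.feynmanKac y (empirical x)) := by
  have := M.isProbabilityMeasure_update_empirical hpos hN y x
  exact M.isProbabilityMeasure_feynmanKac y _

lemma integral_update_empirical {N : ℕ} (y : Y) (x : Fin N → X) {f : X → ℝ} (hf : Measurable f) :
    ∫ z, f z ∂(M.update y (empirical x)) =
      sampleMean (fun z => M.g z y * f z) x / sampleMean (fun z => M.g z y) x := by
  rw [integral_update, integral_empirical x (f := fun z => M.g z y * f z)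
      ((M.measurable_g_left y).mul hf),
    integral_empirical x (M.measurable_g_left y)]

lemma measurable_g_apply {N : ℕ} (i : Fin N) :
    Measurable fun q : Y × (Fin N → X) => M.g (q.2 i) q.1 := by
  change Measurable (Function.uncurry M.g ∘ fun q : Y × (Fin N → X) => (q.2 i, q.1))
  exact M.measurable_g.comp
    (((measurable_pi_apply i).comp measurable_snd).prodMk measurable_fst)

lemma measurable_integral_update_empirical {N : ℕ} {f : X → ℝ} (hf : Measurable f) :
    Measurable fun q : Y × (Fin N → X) => ∫ z, f z ∂(M.update q.1 (empirical q.2)) := by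
  simp_rw [integral_update_empirical M _ _ hf, sampleMean]
  have hg : ∀ i : Fin N, Measurable fun q : Y × (Fin N → X) => M.g (q.2 i) q.1 :=
    M.measurable_g_apply
  have hf' : ∀ i : Fin N, Measurable fun q : Y × (Fin N → X) => f (q.2 i) := fun i =>
    hf.comp ((measurable_pi_apply i).comp measurable_snd)
  exact ((Finset.measurable_fun_sum _ fun i _ => (hg i).mul (hf' i)).div_const _).div
    ((Finset.measurable_fun_sum _ fun i _ => hg i).div_const _)

lemma measurable_feynmanKac_empirical {N : ℕ} {A : Set X} (hA : MeasurableSet A) :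
    Measurable fun q : Y × (Fin N → X) => M.feynmanKac q.1 (empirical q.2) A := by
  have hQ : Measurable fun z => M.Q z A := M.Q.measurable_coe hA
  have h1 : ∀ q : Y × (Fin N → X), M.feynmanKac q.1 (empirical q.2) A =
      ((N : ℝ≥0∞)⁻¹ * ∑ i, ENNReal.ofReal (M.g (q.2 i) q.1))⁻¹ *
        ((N : ℝ≥0∞)⁻¹ * ∑ i, ENNReal.ofReal (M.g (q.2 i) q.1) * M.Q (q.2 i) A) := by
    intro q
    have hg := (M.measurable_g_left q.1).ennreal_ofReal
    rw [feynmanKac, Measure.bind_apply hA M.Q.aemeasurable, update, lintegral_smul_measure,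
      lintegral_withDensity_eq_lintegral_mul _ hg hQ, lintegral_empirical _ hg,
      lintegral_empirical _ (hg.mul hQ)]
    rfl
  simp_rw [h1]
  have hg : ∀ i : Fin N, Measurable fun q : Y × (Fin N → X) => ENNReal.ofReal (M.g (q.2 i) q.1) :=
    fun i => (M.measurable_g_apply i).ennreal_ofReal
  have hf' : ∀ i : Fin N, Measurable fun q : Y × (Fin N → X) => M.Q (q.2 i) A := fun i =>
    hQ.comp ((measurable_pi_apply i).comp measurable_snd)
  exact ((measurable_const.mul (Finset.measurable_fun_sum _ fun i _ => hg i)).inv).mul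
    (measurable_const.mul (Finset.measurable_fun_sum _ fun i _ => (hg i).mul (hf' i)))

/-! ### The law of the particles given the observations -/

/-- One step of the particle system: `N` independent draws from the selection-mutation mixture. -/
def particleStep (hpos : ∀ x y, 0 < M.g x y) {N : ℕ} (hN : 0 < N) :
    Kernel (Y × (Fin N → X)) (Fin N → X) where
  toFun q := Measure.pi fun _ => M.feynmanKac q.1 (empirical q.2)
  measurable' := by
    have hprob : ∀ q : Y × (Fin N → X), IsProbabilityMeasure (M.feynmanKac q.1 (empirical q.2)) :=
      fun q => M.isProbabilityMeasure_feynmanKac_empirical hpos hN q.1 q.2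
    refine Measurable.measure_of_isPiSystem_of_isProbabilityMeasure generateFrom_pi.symm
      isPiSystem_pi ?_
    rintro _ ⟨A, hA, rfl⟩
    simp_rw [Measure.pi_pi]
    exact Finset.measurable_fun_prod _ fun i _ =>
      M.measurable_feynmanKac_empirical (hA i (Set.mem_univ i))

variable (hpos : ∀ x y, 0 < M.g x y) (χ : Measure X) [IsProbabilityMeasure χ] {N : ℕ} (hN : 0 < N)

lemma particleStep_apply (q : Y × (Fin N → X)) :
    M.particleStep hpos hN q = Measure.pi fun _ => M.feynmanKac q.1 (empirical q.2) := rfl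

instance : IsMarkovKernel (M.particleStep hpos hN) := by
  refine ⟨fun q => ?_⟩
  have := M.isProbabilityMeasure_feynmanKac_empirical hpos hN q.1 q.2
  rw [particleStep_apply]
  infer_instance

/-- The step kernel driven by the observation at time `n`. -/
def particleStepAt (n : ℕ) : Kernel ((ℕ → Y) × (Fin N → X)) (Fin N → X) :=
  (M.particleStep hpos hN).comap (fun q => (q.1 n, q.2))
    (((measurable_pi_apply n).comp measurable_fst).prodMk measurable_snd)

instance (n : ℕ) : IsMarkovKernel (M.particleStepAt hpos hN n) := by
  unfold particleStepAt
  infer_instance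

/-- The law of the `N` particles at time `n`, as a kernel from the observation sequences. -/
def particleLaw : ℕ → Kernel (ℕ → Y) (Fin N → X)
  | 0 => Kernel.const _ (Measure.pi fun _ => χ)
  | n + 1 => (particleLaw n ⊗ₖ M.particleStepAt hpos hN n).snd

instance isMarkovKernel_particleLaw (n : ℕ) : IsMarkovKernel (M.particleLaw hpos χ hN n) := by
  induction n with
  | zero => unfold particleLaw; infer_instance
  | succ n ih => unfold particleLaw; infer_instance

lemma integral_particleLaw_succ {E : Type*} [NormedAddCommGroup E] [NormedSpace ℝ E]
    (y : ℕ → Y) (n : ℕ) {F : (Fin N → X) → E} (hF : StronglyMeasurable F) {C : ℝ}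
    (hC : ∀ x, ‖F x‖ ≤ C) :
    ∫ x, F x ∂(M.particleLaw hpos χ hN (n + 1) y) =
      ∫ x, ∫ x', F x' ∂(Measure.pi fun _ => M.feynmanKac (y n) (empirical x))
        ∂(M.particleLaw hpos χ hN n y) := by
  rw [particleLaw, Kernel.snd_apply, integral_map measurable_snd.aemeasurable
    hF.aestronglyMeasurable, integral_compProd]
  · rfl
  · exact Integrable.of_bound (hF.comp_measurable measurable_snd).aestronglyMeasurable C
      (ae_of_all _ fun q => hC _)

/-- This allows conditioning on finitely many observations, although `particleLaw` is a kernel from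
whole sequences. -/
lemma particleLaw_congr {y y' : ℕ → Y} (n : ℕ) (h : ∀ k < n, y k = y' k) :
    M.particleLaw hpos χ hN n y = M.particleLaw hpos χ hN n y' := by
  induction n with
  | zero => rfl
  | succ n ih =>
    ext A hA
    have h1 := ih fun k hk => h k (hk.trans (Nat.lt_succ_self n))
    have hs : ∀ x, M.particleStepAt hpos hN n (y, x) = M.particleStepAt hpos hN n (y', x) := by
      intro x
      simp only [particleStepAt, Kernel.comap_apply]
      rw [h n (Nat.lt_succ_self n)]
    rw [particleLaw, Kernel.snd_apply' _ _ hA, Kernel.snd_apply' _ _ hA,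
      Kernel.compProd_apply (measurable_snd hA), Kernel.compProd_apply (measurable_snd hA), h1]
    simp_rw [hs]

end HiddenMarkovModel

/-! ### Sample means and the rescaled errors of predictor and filter -/

lemma sampleMean_sub_const_mul {X : Type*} {N : ℕ} (f f' : X → ℝ) (c : ℝ) (x : Fin N → X) :
    sampleMean (fun z => f z - c * f' z) x = sampleMean f x - c * sampleMean f' x := by
  simp only [sampleMean, Finset.sum_sub_distrib, ← Finset.mul_sum]
  ring

lemma sampleMean_pos {X : Type*} {N : ℕ} (hN : 0 < N) {f : X → ℝ} (hf : ∀ z, 0 < f z)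
    (x : Fin N → X) : 0 < sampleMean f x := by
  have : Nonempty (Fin N) := ⟨⟨0, hN⟩⟩
  exact div_pos (Finset.sum_pos (fun i _ => hf _) Finset.univ_nonempty) (by exact_mod_cast hN)

lemma abs_sampleMean_le_mul {X : Type*} {N : ℕ} {f f' : X → ℝ} {D : ℝ}
    (h : ∀ z, |f z| ≤ D * f' z) (x : Fin N → X) : |sampleMean f x| ≤ D * sampleMean f' x := by
  simp only [sampleMean]
  rw [abs_div, Nat.abs_cast, ← mul_div_assoc, Finset.mul_sum]
  gcongr
  exact (Finset.abs_sum_le_sum_abs _ _).trans (Finset.sum_le_sum fun i _ => h _)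

namespace HiddenMarkovModel

variable {X Y : Type*} [MeasurableSpace X] [MeasurableSpace Y] (M : HiddenMarkovModel X Y)
  (χ : Measure X) (y : ℕ → Y)

/-- The rescaled error of the particle predictor at time `n`. -/
def predErr (n : ℕ) (f : X → ℝ) {N : ℕ} (x : Fin N → X) : ℝ :=
  √(N : ℝ) * (sampleMean f x - ∫ z, f z ∂(M.pred χ y n))

/-- The rescaled error of the particle filter at time `n`. -/
def filtErr (n : ℕ) (f : X → ℝ) {N : ℕ} (x : Fin N → X) : ℝ :=
  √(N : ℝ) * ((∫ z, f z ∂(M.partFilt (y n) x)) - ∫ z, f z ∂(M.filt χ y n))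

/-- The function `g(·, y_n) (f - φ̄_χ⟨y_0, …, y_n⟩ f)`. -/
def centered (n : ℕ) (f : X → ℝ) (x : X) : ℝ :=
  M.g x (y n) * (f x - ∫ z, f z ∂(M.filt χ y n))

lemma filtVariance_eq (n : ℕ) (f : X → ℝ) : M.filtVariance χ y n f =
    M.predVariance χ y n (M.centered χ y n f) / (∫ x, M.g x (y n) ∂(M.pred χ y n)) ^ 2 := rfl

lemma filtVariance_nonneg (n : ℕ) (f : X → ℝ) : 0 ≤ M.filtVariance χ y n f :=
  div_nonneg (M.predVariance_nonneg χ n _) (sq_nonneg _)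

lemma bddMeas_predErr (n : ℕ) {f : X → ℝ} (hf : BddMeas f) (N : ℕ) :
    BddMeas fun x : Fin N → X => M.predErr χ y n f x :=
  (BddMeas.const _).mul ((hf.sampleMean N).sub (BddMeas.const _))

lemma bddMeas_integral_partFilt (hpos : ∀ x y, 0 < M.g x y) (n : ℕ) {f : X → ℝ} (hf : BddMeas f)
    {N : ℕ} (hN : 0 < N) :
    BddMeas fun x : Fin N → X => ∫ z, f z ∂(M.partFilt (y n) x) := by
  obtain ⟨C, hC⟩ := hf.2
  have hm : Measurable ((fun q : Y × (Fin N → X) => ∫ z, f z ∂(M.update q.1 (empirical q.2))) ∘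
      fun x => (y n, x)) :=
    (M.measurable_integral_update_empirical hf.1).comp measurable_prodMk_left
  refine ⟨hm, C, fun x => ?_⟩
  have := M.isProbabilityMeasure_update_empirical hpos hN (y n) x
  exact BddMeas.abs_integral_le hC (M.update (y n) (empirical x))

lemma bddMeas_filtErr (hpos : ∀ x y, 0 < M.g x y) (n : ℕ) {f : X → ℝ} (hf : BddMeas f) {N : ℕ}
    (hN : 0 < N) : BddMeas fun x : Fin N → X => M.filtErr χ y n f x :=
  (BddMeas.const _).mul ((M.bddMeas_integral_partFilt y hpos n hf hN).sub (BddMeas.const _))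

lemma bddMeas_centered (hb : ∀ k, BddMeas fun x => M.g x (y k)) (n : ℕ) {f : X → ℝ}
    (hf : BddMeas f) : BddMeas (M.centered χ y n f) :=
  (hb n).mul (hf.sub (BddMeas.const _))

variable [IsProbabilityMeasure χ] {y}

lemma isProbabilityMeasure_filt (hpos : ∀ x y, 0 < M.g x y)
    (hb : ∀ k, BddMeas fun x => M.g x (y k)) (n : ℕ) : IsProbabilityMeasure (M.filt χ y n) := by
  have := M.isProbabilityMeasure_pred χ hpos hb n
  exact M.isProbabilityMeasure_update_of_integrable (fun x => hpos x (y n)) ((hb n).integrable _)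

lemma integral_filt_Q (hpos : ∀ x y, 0 < M.g x y) (hb : ∀ k, BddMeas fun x => M.g x (y k))
    (n : ℕ) {f : X → ℝ} (hf : BddMeas f) :
    ∫ x, (∫ x', f x' ∂(M.Q x)) ∂(M.filt χ y n) = ∫ x, f x ∂(M.pred χ y (n + 1)) := by
  rw [integral_pred_succ M χ hpos hb n hf, filt, integral_update]
  rfl

lemma integral_centered (hpos : ∀ x y, 0 < M.g x y) (hb : ∀ k, BddMeas fun x => M.g x (y k))
    (n : ℕ) {f : X → ℝ} (hf : BddMeas f) : ∫ x, M.centered χ y n f x ∂(M.pred χ y n) = 0 := by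
  have := M.isProbabilityMeasure_pred χ hpos hb n
  have hg := (hb n).integral_pos (fun x => hpos x (y n)) (M.pred χ y n)
  simp_rw [centered, mul_sub]
  rw [integral_sub (((hb n).mul hf).integrable _) (((hb n).integrable _).mul_const _),
    integral_mul_const, filt, integral_update, mul_div_cancel₀ _ hg.ne', sub_self]

/-- The variance counterpart of the error splitting `predErr_succ_eq_add`. -/
lemma predVariance_succ_eq_add_filtVariance (hpos : ∀ x y, 0 < M.g x y)
    (hb : ∀ k, BddMeas fun x => M.g x (y k)) (n : ℕ) {f : X → ℝ} (hf : BddMeas f) :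
    M.predVariance χ y (n + 1) f =
      (∫ x, (f x - ∫ x', f x' ∂(M.pred χ y (n + 1))) ^ 2 ∂(M.pred χ y (n + 1))) +
      M.filtVariance χ y n (fun x => ∫ x', f x' ∂(M.Q x)) := by
  rw [predVariance_succ M χ hpos hb n hf, filtVariance, integral_filt_Q M χ hpos hb n hf]

/-! ### Comparison of the filter error with the predictor error -/

lemma integral_partFilt_sub_eq_div {y : ℕ → Y} (χ : Measure X) (hpos : ∀ x y, 0 < M.g x y) (n : ℕ)
    {f : X → ℝ} (hf : BddMeas f) {N : ℕ} (hN : 0 < N) (x : Fin N → X) :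
    (∫ z, f z ∂(M.partFilt (y n) x)) - ∫ z, f z ∂(M.filt χ y n) =
      sampleMean (M.centered χ y n f) x / sampleMean (fun z => M.g z (y n)) x := by
  have hB := sampleMean_pos hN (fun z => hpos z (y n)) x
  have h1 : M.centered χ y n f = fun z => M.g z (y n) * f z -
      (∫ z, f z ∂(M.filt χ y n)) * M.g z (y n) := by
    ext z
    simp only [centered]
    ring
  rw [partFilt, integral_update_empirical M _ _ hf.1, h1,
    sampleMean_sub_const_mul (fun z => M.g z (y n) * f z), sub_div, mul_div_cancel_right₀ _ hB.ne']

/-- The inequality holds pointwise before averaging, since f differs from its filter mean by at most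
2C. It supplies the constant D of the ratio estimates. -/
lemma abs_sampleMean_centered_le (hpos : ∀ x y, 0 < M.g x y)
    (hb : ∀ k, BddMeas fun x => M.g x (y k)) (n : ℕ) {f : X → ℝ} {C : ℝ} (hC : ∀ x, |f x| ≤ C)
    {N : ℕ} (x : Fin N → X) : |sampleMean (M.centered χ y n f) x| ≤
    2 * C * sampleMean (fun z => M.g z (y n)) x := by
  have := M.isProbabilityMeasure_filt χ hpos hb n
  refine abs_sampleMean_le_mul (fun z => ?_) x
  have h1 := BddMeas.abs_integral_le hC (M.filt χ y n)
  have h2 := abs_sub (f z) (∫ z, f z ∂(M.filt χ y n))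
  rw [centered, abs_mul, abs_of_pos (hpos _ _), mul_comm]
  gcongr
  · exact (hpos _ _).le
  · linarith [hC z]

lemma abs_filtErr_le (hpos : ∀ x y, 0 < M.g x y)
    (hb : ∀ k, BddMeas fun x => M.g x (y k)) (n : ℕ) {f : X → ℝ} (hf : BddMeas f)
    {C : ℝ} (hC : ∀ x, |f x| ≤ C) {N : ℕ} (hN : 0 < N) (x : Fin N → X) : |M.filtErr χ y n f x| ≤
    |M.predErr χ y n (M.centered χ y n f) x| / (∫ z, M.g z (y n) ∂(M.pred χ y n)) +
    2 * C * |M.predErr χ y n (fun z => M.g z (y n)) x| / ∫ z, M.g z (y n) ∂(M.pred χ y n) := by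
  have := M.isProbabilityMeasure_pred χ hpos hb n
  have hg := (hb n).integral_pos (fun x => hpos x (y n)) (M.pred χ y n)
  have h := abs_div_le_of_abs_le_mul hg (sampleMean_pos hN (fun z => hpos z (y n)) x)
    (M.abs_sampleMean_centered_le χ hpos hb n hC x)
  simp only [filtErr, predErr]
  rw [integral_partFilt_sub_eq_div M χ hpos n hf hN, integral_centered M χ hpos hb n hf, sub_zero,
    abs_mul, abs_mul, abs_mul, abs_of_nonneg (Real.sqrt_nonneg _)]
  calc _ ≤ _ := mul_le_mul_of_nonneg_left h (Real.sqrt_nonneg (N : ℝ))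
    _ = _ := by ring

/-- The unscaled linearization error is quadratic in deviations of size 1/√N; one factor √N is spent
on the rescaling, leaving 1/√N. -/
lemma abs_filtErr_sub_le (hpos : ∀ x y, 0 < M.g x y)
    (hb : ∀ k, BddMeas fun x => M.g x (y k)) (n : ℕ) {f : X → ℝ} (hf : BddMeas f)
    {C : ℝ} (hC : ∀ x, |f x| ≤ C) {N : ℕ} (hN : 0 < N) (x : Fin N → X) : |M.filtErr χ y n f x -
      M.predErr χ y n (M.centered χ y n f) x / ∫ z, M.g z (y n) ∂(M.pred χ y n)| ≤
    (|M.predErr χ y n (M.centered χ y n f) x| * |M.predErr χ y n (fun z => M.g z (y n)) x| +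
      2 * C * |M.predErr χ y n (fun z => M.g z (y n)) x| ^ 2) /
      (∫ z, M.g z (y n) ∂(M.pred χ y n)) ^ 2 / √N := by
  have := M.isProbabilityMeasure_pred χ hpos hb n
  have hg := (hb n).integral_pos (fun x => hpos x (y n)) (M.pred χ y n)
  have hs : 0 < √(N : ℝ) := Real.sqrt_pos.2 (by exact_mod_cast hN)
  have h := abs_div_sub_div_le_of_abs_le_mul hg (sampleMean_pos hN (fun z => hpos z (y n)) x)
    (M.abs_sampleMean_centered_le χ hpos hb n hC x)
  simp only [filtErr, predErr]
  rw [integral_partFilt_sub_eq_div M χ hpos n hf hN, integral_centered M χ hpos hb n hf, sub_zero,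
    mul_div_assoc, ← mul_sub, abs_mul, abs_mul, abs_mul, abs_of_nonneg hs.le]
  calc _ ≤ _ := mul_le_mul_of_nonneg_left h hs.le
    _ = _ := by
      field_simp

/-! ### Uniform exponential moments -/

/-- Exponential moments of the filter error, given those of the predictor error. -/
lemma exists_expMoment_filtErr_le_of_pred (hpos : ∀ x y, 0 < M.g x y)
    (hb : ∀ k, BddMeas fun x => M.g x (y k)) (n : ℕ)
    (ih : ∀ f : X → ℝ, BddMeas f → ∀ s : ℝ, 0 ≤ s → ∃ K, ∀ (N : ℕ) (hN : 0 < N),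
      ∫ x, Real.exp (s * |M.predErr χ y n f x|) ∂(M.particleLaw hpos χ hN n y) ≤ K)
    {f : X → ℝ} (hf : BddMeas f) {s : ℝ} (hs : 0 ≤ s) : ∃ K, ∀ (N : ℕ) (hN : 0 < N),
      ∫ x, Real.exp (s * |M.filtErr χ y n f x|) ∂(M.particleLaw hpos χ hN n y) ≤ K := by
  have := M.isProbabilityMeasure_pred χ hpos hb n
  have hg := (hb n).integral_pos (fun x => hpos x (y n)) (M.pred χ y n)
  obtain ⟨C, hC0, hC⟩ := hf.exists_nonneg_bound
  set b := ∫ z, M.g z (y n) ∂(M.pred χ y n) with hbdef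
  have hcen := M.bddMeas_centered χ y hb n hf
  -- The coefficients 1/b and 2C/b of `abs_filtErr_le`, times s, doubled by `exp_add_le`.
  obtain ⟨K₁, hK₁⟩ := ih _ hcen (2 * s / b) (by positivity)
  obtain ⟨K₂, hK₂⟩ := ih _ (hb n) (4 * C * s / b) (by positivity)
  refine ⟨(K₁ + K₂) / 2, fun N hN => ?_⟩
  have i1 := ((BddMeas.const (2 * s / b)).mul
    (M.bddMeas_predErr χ y n hcen N).abs).exp.integrable (M.particleLaw hpos χ hN n y)
  have i2 := ((BddMeas.const (4 * C * s / b)).mul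
    (M.bddMeas_predErr χ y n (hb n) N).abs).exp.integrable (M.particleLaw hpos χ hN n y)
  have i0 := ((BddMeas.const s).mul
    (M.bddMeas_filtErr χ y hpos n hf hN).abs).exp.integrable (M.particleLaw hpos χ hN n y)
  have h := integral_mono i0 ((i1.add i2).div_const 2) fun x => by
    have h1 := M.abs_filtErr_le χ hpos hb n hf hC hN x
    rw [← hbdef] at h1
    refine le_trans (Real.exp_le_exp.2 (mul_le_mul_of_nonneg_left h1 hs)) ?_
    rw [mul_add]
    refine (exp_add_le _ _).trans (le_of_eq ?_)
    simp only [Pi.add_apply]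
    congr 3 <;> ring_nf
  rw [integral_div] at h
  simp only [Pi.add_apply] at h
  rw [integral_add i1 i2] at h
  linarith [hK₁ N hN, hK₂ N hN]

lemma integral_feynmanKac_empirical {N : ℕ} (hpos : ∀ x y, 0 < M.g x y) (hN : 0 < N) (y : Y)
    (x : Fin N → X) {f : X → ℝ} (hf : BddMeas f) :
    ∫ z, f z ∂(M.feynmanKac y (empirical x)) =
      ∫ z, (∫ z', f z' ∂(M.Q z)) ∂(M.partFilt y x) := by
  have := M.isProbabilityMeasure_update_empirical hpos hN y x
  exact M.integral_feynmanKac y _ hf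

/-- The mean of f under the mixture from which the new particles are drawn is added and subtracted.
Given x, the first term is a centered i.i.d. mean and the second is constant. -/
lemma predErr_succ_eq_add (hpos : ∀ x y, 0 < M.g x y)
    (hb : ∀ k, BddMeas fun x => M.g x (y k)) (n : ℕ)
    {f : X → ℝ} (hf : BddMeas f) {N : ℕ} (hN : 0 < N) (x x' : Fin N → X) :
    M.predErr χ y (n + 1) f x' =
      √(N : ℝ) * (sampleMean f x' - ∫ z, f z ∂(M.feynmanKac (y n) (empirical x))) +
      M.filtErr χ y n (fun z => ∫ z', f z' ∂(M.Q z)) x := by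
  rw [predErr, filtErr, integral_feynmanKac_empirical M hpos hN _ _ hf,
    integral_filt_Q M χ hpos hb n hf]
  ring

/-- Given the particles at time n, Hoeffding bounds the exponential moment of the fresh error by a
constant independent of them. It factors out, and the filter error for Qf is covered by induction.
-/
theorem exists_expMoment_predErr_le (hpos : ∀ x y, 0 < M.g x y)
    (hb : ∀ k, BddMeas fun x => M.g x (y k)) (n : ℕ)
    {f : X → ℝ} (hf : BddMeas f) {s : ℝ} (hs : 0 ≤ s) :
    ∃ K, ∀ (N : ℕ) (hN : 0 < N),
      ∫ x, Real.exp (s * |M.predErr χ y n f x|) ∂(M.particleLaw hpos χ hN n y) ≤ K := by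
  induction n generalizing f s with
  | zero =>
    obtain ⟨C, hC⟩ := hf.2
    refine ⟨2 * Real.exp (C ^ 2 * s ^ 2 / 2), fun N hN => ?_⟩
    have h := integral_pi_exp_abs_sampleMean_le χ hf.1 hC hs hN
    rw [← M.integral_pred_zero χ hb hf] at h
    exact h
  | succ n ih =>
    obtain ⟨C, hC⟩ := hf.2
    obtain ⟨K, hK⟩ := M.exists_expMoment_filtErr_le_of_pred χ hpos hb n
      (fun f hf s hs => ih hf hs) (hf.kernel_integral M.Q) hs
    refine ⟨K * (2 * Real.exp (C ^ 2 * s ^ 2 / 2)), fun N hN => ?_⟩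
    have hbd := ((BddMeas.const s).mul (M.bddMeas_predErr χ y (n + 1) hf N).abs).exp
    obtain ⟨D, hD⟩ := hbd.2
    have hfe := ((BddMeas.const s).mul
      (M.bddMeas_filtErr χ y hpos n (hf.kernel_integral M.Q) hN).abs).exp.integrable
      (M.particleLaw hpos χ hN n y)
    rw [integral_particleLaw_succ M hpos χ hN y n hbd.1.stronglyMeasurable hD]
    refine (integral_mono_of_nonneg (ae_of_all _ fun x => integral_nonneg fun _ =>
      (Real.exp_pos _).le) (hfe.mul_const (2 * Real.exp (C ^ 2 * s ^ 2 / 2)))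
      (ae_of_all _ fun x => ?_)).trans ?_
    · have := M.isProbabilityMeasure_feynmanKac_empirical hpos hN (y n) x
      have h := integral_pi_exp_abs_sampleMean_le (M.feynmanKac (y n) (empirical x)) hf.1 hC hs hN
      simp only
      refine le_trans ?_ (mul_le_mul_of_nonneg_left h (Real.exp_pos _).le)
      rw [← integral_const_mul]
      refine integral_mono (hbd.integrable _) ((((BddMeas.const s).mul ((BddMeas.const _).mul
        ((hf.sampleMean N).sub (BddMeas.const _))).abs).exp.integrable _).const_mul _) fun x' => ?_
      simp only
      rw [← Real.exp_add, ← mul_add, M.predErr_succ_eq_add χ hpos hb n hf hN x x']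
      refine Real.exp_le_exp.2 (mul_le_mul_of_nonneg_left ?_ hs)
      rw [add_comm]
      exact abs_add_le _ _
    · rw [integral_mul_const]
      exact mul_le_mul_of_nonneg_right (hK N hN) (by positivity)

theorem exists_expMoment_filtErr_le (hpos : ∀ x y, 0 < M.g x y)
    (hb : ∀ k, BddMeas fun x => M.g x (y k)) (n : ℕ)
    {f : X → ℝ} (hf : BddMeas f) {s : ℝ} (hs : 0 ≤ s) :
    ∃ K, ∀ (N : ℕ) (hN : 0 < N),
      ∫ x, Real.exp (s * |M.filtErr χ y n f x|) ∂(M.particleLaw hpos χ hN n y) ≤ K :=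
  M.exists_expMoment_filtErr_le_of_pred χ hpos hb n
    (fun _ hf _ hs => M.exists_expMoment_predErr_le χ hpos hb n hf hs) hf hs

lemma exists_integral_abs_filtErr_le (hpos : ∀ x y, 0 < M.g x y)
    (hb : ∀ k, BddMeas fun x => M.g x (y k)) (n : ℕ)
    {f : X → ℝ} (hf : BddMeas f) :
    ∃ K, ∀ (N : ℕ) (hN : 0 < N),
      ∫ x, |M.filtErr χ y n f x| ∂(M.particleLaw hpos χ hN n y) ≤ K := by
  obtain ⟨K, hK⟩ := M.exists_expMoment_filtErr_le χ hpos hb n hf zero_le_one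
  refine ⟨K, fun N hN => (integral_mono ((M.bddMeas_filtErr χ y hpos n hf hN).abs.integrable _)
    (((BddMeas.const 1).mul (M.bddMeas_filtErr χ y hpos n hf hN).abs).exp.integrable _)
    fun x => ?_).trans (hK N hN)⟩
  simp only [one_mul]
  linarith [Real.add_one_le_exp |M.filtErr χ y n f x|]

lemma exists_integral_abs_filtErr_sub_le (hpos : ∀ x y, 0 < M.g x y)
    (hb : ∀ k, BddMeas fun x => M.g x (y k)) (n : ℕ)
    {f : X → ℝ} (hf : BddMeas f) :
    ∃ K, ∀ (N : ℕ) (hN : 0 < N),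
      ∫ x, |M.filtErr χ y n f x - M.predErr χ y n (M.centered χ y n f) x /
        ∫ z, M.g z (y n) ∂(M.pred χ y n)| ∂(M.particleLaw hpos χ hN n y) ≤ K / √N := by
  have hcen := M.bddMeas_centered χ y hb n hf
  obtain ⟨C, hC0, hC⟩ := hf.exists_nonneg_bound
  obtain ⟨K₁, hK₁⟩ := M.exists_expMoment_predErr_le χ hpos hb n hcen zero_le_one
  obtain ⟨K₂, hK₂⟩ := M.exists_expMoment_predErr_le χ hpos hb n (hb n) zero_le_one
  set b := ∫ z, M.g z (y n) ∂(M.pred χ y n) with hbdef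
  -- From |ac| ≤ (a² + c²)/2 and r² ≤ 2e^|r|: the product costs K₁ + K₂, the term 2Cc² costs 4C K₂.
  refine ⟨(K₁ + (1 + 4 * C) * K₂) / b ^ 2, fun N hN => ?_⟩
  have k₁ := hK₁ N hN
  have k₂ := hK₂ N hN
  simp only [one_mul] at k₁ k₂
  have i1 := (M.bddMeas_predErr χ y n hcen N).abs.exp.integrable (M.particleLaw hpos χ hN n y)
  have i2 := (M.bddMeas_predErr χ y n (hb n) N).abs.exp.integrable (M.particleLaw hpos χ hN n y)
  have i0 := ((M.bddMeas_filtErr χ y hpos n hf hN).sub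
    ((M.bddMeas_predErr χ y n hcen N).div_const b)).abs.integrable (M.particleLaw hpos χ hN n y)
  refine (integral_mono i0 (((i1.add (i2.const_mul (1 + 4 * C))).div_const (b ^ 2)).div_const √N)
    fun x => ?_).trans ?_
  · refine (M.abs_filtErr_sub_le χ hpos hb n hf hC hN x).trans ?_
    rw [← hbdef]
    simp only [Pi.add_apply]
    refine div_le_div_of_nonneg_right (div_le_div_of_nonneg_right ?_ (sq_nonneg _))
      (Real.sqrt_nonneg _)
    have h1 := sq_le_two_mul_exp_abs (M.predErr χ y n (M.centered χ y n f) x)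
    have h2 := sq_le_two_mul_exp_abs (M.predErr χ y n (fun z => M.g z (y n)) x)
    rw [← sq_abs] at h1 h2
    nlinarith [sq_nonneg (|M.predErr χ y n (M.centered χ y n f) x| -
      |M.predErr χ y n (fun z => M.g z (y n)) x|), mul_le_mul_of_nonneg_left h2 hC0]
  · rw [integral_div, integral_div]
    simp only [Pi.add_apply]
    rw [integral_add i1 (i2.const_mul _), integral_const_mul]
    gcongr

end HiddenMarkovModel

lemma integral_sq_sub_eq {α : Type*} [MeasurableSpace α] {f : α → ℝ} (hf : BddMeas f)
    (μ : Measure α) [IsProbabilityMeasure μ] :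
    ∫ x, (f x - ∫ z, f z ∂μ) ^ 2 ∂μ = ∫ x, f x ^ 2 ∂μ - (∫ x, f x ∂μ) ^ 2 := by
  rw [← variance_eq_integral hf.1.aemeasurable, variance_eq_sub]
  · rfl
  · obtain ⟨C, hC⟩ := hf.2
    exact MemLp.of_bound hf.1.aestronglyMeasurable C (ae_of_all _ hC)

lemma norm_integral_cexp_sub_le {α : Type*} [MeasurableSpace α] {V W : α → ℝ} (hV : BddMeas V)
    (hW : BddMeas W) (t : ℝ) (μ : Measure α) [IsProbabilityMeasure μ] :
    ‖∫ x, Complex.exp (Complex.I * ((t * V x : ℝ) : ℂ)) ∂μ -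
      ∫ x, Complex.exp (Complex.I * ((t * W x : ℝ) : ℂ)) ∂μ‖ ≤ |t| * ∫ x, |V x - W x| ∂μ := by
  rw [← integral_sub (integrable_cexp_I_mul ((BddMeas.const t).mul hV).1 μ)
    (integrable_cexp_I_mul ((BddMeas.const t).mul hW).1 μ), ← integral_const_mul]
  refine norm_integral_le_of_norm_le (((hV.sub hW).abs.integrable μ).const_mul _)
    (ae_of_all _ fun x => (norm_cexp_I_mul_sub_le _ _).trans (le_of_eq ?_))
  rw [← mul_sub, abs_mul]

namespace HiddenMarkovModel

variable {X Y : Type*} [MeasurableSpace X] [MeasurableSpace Y] (M : HiddenMarkovModel X Y)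
  (χ : Measure X) [IsProbabilityMeasure χ] {y : ℕ → Y}

lemma stronglyMeasurable_integral_pi_feynmanKac {E : Type*} [NormedAddCommGroup E]
    [NormedSpace ℝ E] (hpos : ∀ x y, 0 < M.g x y) {N : ℕ} (hN : 0 < N) (y : Y) {F : (Fin N → X) → E}
    (hF : StronglyMeasurable F) : StronglyMeasurable fun x : Fin N → X =>
      ∫ x', F x' ∂(Measure.pi fun _ => M.feynmanKac y (empirical x)) := by
  have h := hF.integral_kernel
    (κ := (M.particleStep hpos hN).comap (fun x => (y, x)) measurable_prodMk_left)
  simpa only [Kernel.comap_apply, particleStep_apply] using h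

/-! ### Central limit theorem in terms of characteristic functions -/

/-- The characteristic function is Lipschitz in L¹, so the linearized error may replace the filter
error. Its factor 1/b is absorbed into the frequency t/b and reappears as the 1/b² of
`filtVariance_eq`. -/
lemma exists_charFun_filtErr_of_pred (hpos : ∀ x y, 0 < M.g x y)
    (hb : ∀ k, BddMeas fun x => M.g x (y k)) (n : ℕ)
    (ih : ∀ f : X → ℝ, BddMeas f → ∀ t : ℝ, ∃ K, ∀ (N : ℕ) (hN : 0 < N),
      ‖∫ x, Complex.exp (Complex.I * ((t * M.predErr χ y n f x : ℝ) : ℂ))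
          ∂(M.particleLaw hpos χ hN n y) -
        ((Real.exp (-(t ^ 2 * M.predVariance χ y n f / 2)) : ℝ) : ℂ)‖ ≤ K / √N)
    {f : X → ℝ} (hf : BddMeas f) (t : ℝ) : ∃ K, ∀ (N : ℕ) (hN : 0 < N),
      ‖∫ x, Complex.exp (Complex.I * ((t * M.filtErr χ y n f x : ℝ) : ℂ))
          ∂(M.particleLaw hpos χ hN n y) -
        ((Real.exp (-(t ^ 2 * M.filtVariance χ y n f / 2)) : ℝ) : ℂ)‖ ≤ K / √N := by
  have hcen := M.bddMeas_centered χ y hb n hf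
  set b := ∫ z, M.g z (y n) ∂(M.pred χ y n) with hbdef
  obtain ⟨K₁, hK₁⟩ := ih _ hcen (t / b)
  obtain ⟨K₂, hK₂⟩ := M.exists_integral_abs_filtErr_sub_le χ hpos hb n hf
  refine ⟨|t| * K₂ + K₁, fun N hN => ?_⟩
  have h1 := norm_integral_cexp_sub_le (M.bddMeas_filtErr χ y hpos n hf hN)
    ((M.bddMeas_predErr χ y n hcen N).div_const b) t (M.particleLaw hpos χ hN n y)
  have h2 := hK₁ N hN
  have h3 : (t / b) ^ 2 * M.predVariance χ y n (M.centered χ y n f) / 2 =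
      t ^ 2 * M.filtVariance χ y n f / 2 := by
    rw [filtVariance_eq, ← hbdef]
    ring
  have h4 : ∀ x : Fin N → X, t / b * M.predErr χ y n (M.centered χ y n f) x =
      t * (M.predErr χ y n (M.centered χ y n f) x / b) := fun x => by ring
  simp_rw [h3, h4] at h2
  refine (norm_sub_le_norm_sub_add_norm_sub _ _ _).trans ((add_le_add h1 h2).trans ?_)
  rw [add_div, mul_div_assoc]
  gcongr
  exact hK₂ N hN

/-- Writing each variance as a second moment minus a squared mean leaves only filter errors, for
Q(f²) and Qf. The squares are handled by a² - c² = (a + c)(a - c) with |a + c| ≤ 2C. -/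
lemma exists_integral_abs_variance_sub_le (hpos : ∀ x y, 0 < M.g x y)
    (hb : ∀ k, BddMeas fun x => M.g x (y k)) (n : ℕ)
    {f : X → ℝ} (hf : BddMeas f) :
    ∃ K, ∀ (N : ℕ) (hN : 0 < N),
      BddMeas (fun x : Fin N → X => ∫ z, (f z - ∫ z, f z ∂(M.feynmanKac (y n) (empirical x))) ^ 2
        ∂(M.feynmanKac (y n) (empirical x))) ∧
      ∫ x : Fin N → X, |(∫ z, (f z - ∫ z, f z ∂(M.feynmanKac (y n) (empirical x))) ^ 2
          ∂(M.feynmanKac (y n) (empirical x))) -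
        ∫ z, (f z - ∫ z, f z ∂(M.pred χ y (n + 1))) ^ 2 ∂(M.pred χ y (n + 1))|
        ∂(M.particleLaw hpos χ hN n y) ≤ K / √N := by
  have hp1 := M.isProbabilityMeasure_pred χ hpos hb (n + 1)
  obtain ⟨C, hC0, hC⟩ := hf.exists_nonneg_bound
  have hQ := hf.kernel_integral M.Q
  have hQ2 := (hf.pow 2).kernel_integral M.Q
  obtain ⟨K₁, hK₁⟩ := M.exists_integral_abs_filtErr_le χ hpos hb n hQ
  obtain ⟨K₂, hK₂⟩ := M.exists_integral_abs_filtErr_le χ hpos hb n hQ2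
  refine ⟨K₂ + 2 * C * K₁, fun N hN => ?_⟩
  have hs : 0 < √(N : ℝ) := Real.sqrt_pos.2 (by exact_mod_cast hN)
  have hv : ∀ x : Fin N → X, ∫ z, (f z - ∫ z, f z ∂(M.feynmanKac (y n) (empirical x))) ^ 2
      ∂(M.feynmanKac (y n) (empirical x)) =
      (∫ z, (∫ z', f z' ^ 2 ∂(M.Q z)) ∂(M.partFilt (y n) x)) -
        (∫ z, (∫ z', f z' ∂(M.Q z)) ∂(M.partFilt (y n) x)) ^ 2 := by
    intro x
    have := M.isProbabilityMeasure_feynmanKac_empirical hpos hN (y n) x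
    rw [integral_sq_sub_eq hf, integral_feynmanKac_empirical M hpos hN _ _ (hf.pow 2),
      integral_feynmanKac_empirical M hpos hN _ _ hf]
  simp_rw [hv]
  have hB := (M.bddMeas_integral_partFilt y hpos n hQ2 hN).sub
    ((M.bddMeas_integral_partFilt y hpos n hQ hN).pow 2)
  refine ⟨hB, ?_⟩
  have i1 := (M.bddMeas_filtErr χ y hpos n hQ hN).abs.integrable (M.particleLaw hpos χ hN n y)
  have i2 := (M.bddMeas_filtErr χ y hpos n hQ2 hN).abs.integrable (M.particleLaw hpos χ hN n y)
  refine (integral_mono ((hB.sub (BddMeas.const _)).abs.integrable _)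
    ((i2.add (i1.const_mul (2 * C))).div_const √N) fun x => ?_).trans ?_
  · simp only [Pi.add_apply]
    rw [integral_sq_sub_eq hf, ← integral_filt_Q M χ hpos hb n hf,
      ← integral_filt_Q M χ hpos hb n (hf.pow 2), le_div_iff₀ hs]
    simp only [filtErr]
    rw [abs_mul, abs_mul, abs_of_pos hs]
    have := M.isProbabilityMeasure_update_empirical hpos hN (y n) x
    have := M.isProbabilityMeasure_filt χ hpos hb n
    have hQC : ∀ z, |∫ z', f z' ∂(M.Q z)| ≤ C := fun z => BddMeas.abs_integral_le hC _
    have ha : |∫ z, (∫ z', f z' ∂(M.Q z)) ∂(M.partFilt (y n) x)| ≤ C :=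
      BddMeas.abs_integral_le hQC (M.update (y n) (empirical x))
    have hc := BddMeas.abs_integral_le hQC (M.filt χ y n)
    generalize ∫ z, (∫ z', f z' ∂(M.Q z)) ∂(M.partFilt (y n) x) = a at *
    generalize ∫ z, (∫ z', f z' ∂(M.Q z)) ∂(M.filt χ y n) = c at *
    generalize ∫ z, (∫ z', f z' ^ 2 ∂(M.Q z)) ∂(M.partFilt (y n) x) = a2 at *
    generalize ∫ z, (∫ z', f z' ^ 2 ∂(M.Q z)) ∂(M.filt χ y n) = c2 at *
    have h1 : a2 - a ^ 2 - (c2 - c ^ 2) = (a2 - c2) - (a + c) * (a - c) := by ring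
    have h2 : |a2 - a ^ 2 - (c2 - c ^ 2)| ≤ |a2 - c2| + 2 * C * |a - c| := by
      rw [h1]
      refine (abs_sub _ _).trans ?_
      rw [abs_mul]
      gcongr
      exact (abs_add_le _ _).trans (by linarith)
    calc _ ≤ (|a2 - c2| + 2 * C * |a - c|) * √N := by gcongr
      _ = _ := by ring
  · rw [integral_div]
    simp only [Pi.add_apply]
    rw [integral_add i2 (i1.const_mul _), integral_const_mul]
    gcongr
    · exact hK₂ N hN
    · exact hK₁ N hN

/-- Conditionally on the particles at time n, the characteristic function is close to exp(itV)
exp(-t²v/2), with V the filter error for Qf and v the limiting variance of f. Averaging over V uses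
the filter estimate derived from the induction hypothesis. -/
theorem exists_charFun_predErr (hpos : ∀ x y, 0 < M.g x y)
    (hb : ∀ k, BddMeas fun x => M.g x (y k)) (n : ℕ)
    {f : X → ℝ} (hf : BddMeas f) (t : ℝ) :
    ∃ K, ∀ (N : ℕ) (hN : 0 < N),
      ‖∫ x, Complex.exp (Complex.I * ((t * M.predErr χ y n f x : ℝ) : ℂ))
          ∂(M.particleLaw hpos χ hN n y) -
        ((Real.exp (-(t ^ 2 * M.predVariance χ y n f / 2)) : ℝ) : ℂ)‖ ≤ K / √N := by
  induction n generalizing f t with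
  | zero =>
    obtain ⟨C, hC⟩ := hf.2
    refine ⟨32 * |t| ^ 3 * C ^ 3 + 4 * t ^ 4 * C ^ 4, fun N hN => ?_⟩
    have h := norm_integral_pi_cexp_sampleMean_sub_le χ hf.1 hC t hN
    rw [← predVariance_zero M χ hb hf, ← M.integral_pred_zero χ hb hf] at h
    exact h
  | succ n ih =>
    obtain ⟨C, hC⟩ := hf.2
    have hQ := hf.kernel_integral M.Q
    obtain ⟨K₁, hK₁⟩ := M.exists_charFun_filtErr_of_pred χ hpos hb n
      (fun f hf t => ih hf t) hQ t
    obtain ⟨K₂, hK₂⟩ := M.exists_integral_abs_variance_sub_le χ hpos hb n hf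
    set v := ∫ z, (f z - ∫ z, f z ∂(M.pred χ y (n + 1))) ^ 2 ∂(M.pred χ y (n + 1)) with hv
    have hv0 : 0 ≤ v := integral_nonneg fun _ => sq_nonneg _
    set K₀ := 32 * |t| ^ 3 * C ^ 3 + 4 * t ^ 4 * C ^ 4 with hK₀
    -- In this order: Gaussian approximation of the fresh draws, replacement of their conditional
    -- variance by its limit, and the propagated filter error.
    refine ⟨K₀ + t ^ 2 / 2 * K₂ + K₁, fun N hN => ?_⟩
    set μ := M.particleLaw hpos χ hN n y with hμ
    obtain ⟨hvB, hv2⟩ := hK₂ N hN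
    set vx : (Fin N → X) → ℝ := fun x =>
      ∫ z, (f z - ∫ z, f z ∂(M.feynmanKac (y n) (empirical x))) ^ 2
        ∂(M.feynmanKac (y n) (empirical x)) with hvx
    have hmeas : Measurable fun x : Fin N → X => t * M.predErr χ y (n + 1) f x :=
      ((BddMeas.const t).mul (M.bddMeas_predErr χ y (n + 1) hf N)).1
    have hmeasC : StronglyMeasurable fun x : Fin N → X =>
        Complex.exp (Complex.I * ((t * M.predErr χ y (n + 1) f x : ℝ) : ℂ)) :=
      Measurable.stronglyMeasurable (by fun_prop)
    rw [integral_particleLaw_succ M hpos χ hN y n hmeasC fun x => norm_cexp_I_mul_le_one _]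
    set V : (Fin N → X) → ℝ := fun x => M.filtErr χ y n (fun z => ∫ z', f z' ∂(M.Q z)) x with hV
    have hVB : BddMeas V := M.bddMeas_filtErr χ y hpos n hQ hN
    set F : (Fin N → X) → ℂ := fun x => ∫ x',
      Complex.exp (Complex.I * ((t * M.predErr χ y (n + 1) f x' : ℝ) : ℂ))
      ∂(Measure.pi fun _ => M.feynmanKac (y n) (empirical x)) with hF
    have hFm : StronglyMeasurable F :=
      M.stronglyMeasurable_integral_pi_feynmanKac hpos hN (y n) hmeasC
    have hF1 : ∀ x, ‖F x‖ ≤ 1 := fun x => by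
      have := M.isProbabilityMeasure_feynmanKac_empirical hpos hN (y n) x
      exact norm_integral_cexp_I_mul_le_one _ _
    have hFi : Integrable F μ := Integrable.of_bound hFm.aestronglyMeasurable 1 (ae_of_all _ hF1)
    have hFx : ∀ x, ‖F x - Complex.exp (Complex.I * ((t * V x : ℝ) : ℂ)) *
        ((Real.exp (-(t ^ 2 * v / 2)) : ℝ) : ℂ)‖ ≤ K₀ / √N + t ^ 2 / 2 * |vx x - v| := by
      intro x
      have := M.isProbabilityMeasure_feynmanKac_empirical hpos hN (y n) x
      have h := norm_integral_pi_cexp_sampleMean_sub_le (M.feynmanKac (y n) (empirical x))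
        hf.1 hC t hN
      -- Given x the filter error is constant, so its exponential leaves the inner integral.
      have hsplit : F x = Complex.exp (Complex.I * ((t * V x : ℝ) : ℂ)) *
          ∫ x' : Fin N → X, Complex.exp (Complex.I * ((t * (√(N : ℝ) * (sampleMean f x' -
            ∫ z, f z ∂(M.feynmanKac (y n) (empirical x)))) : ℝ) : ℂ))
            ∂(Measure.pi fun _ => M.feynmanKac (y n) (empirical x)) := by
        rw [hF, ← integral_const_mul]
        refine integral_congr_ae (ae_of_all _ fun x' => ?_)
        simp only
        rw [M.predErr_succ_eq_add χ hpos hb n hf hN x x', ← Complex.exp_add, hV]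
        congr 1
        push_cast
        ring
      rw [hsplit, ← mul_sub, norm_mul]
      have hvx0 : 0 ≤ vx x := integral_nonneg fun _ => sq_nonneg _
      have he : ‖((Real.exp (-(t ^ 2 * vx x / 2)) : ℝ) : ℂ) -
          ((Real.exp (-(t ^ 2 * v / 2)) : ℝ) : ℂ)‖ ≤ t ^ 2 / 2 * |vx x - v| := by
        rw [← Complex.ofReal_sub, Complex.norm_real, Real.norm_eq_abs]
        refine (abs_exp_neg_sub_exp_neg_le (by positivity) (by positivity)).trans (le_of_eq ?_)
        rw [← sub_div, ← mul_sub, mul_div_right_comm, abs_mul,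
          abs_of_nonneg (by positivity : 0 ≤ t ^ 2 / 2)]
      calc _ ≤ 1 * (K₀ / √N + t ^ 2 / 2 * |vx x - v|) := by
            gcongr
            · exact norm_cexp_I_mul_le_one _
            · exact (norm_sub_le_norm_sub_add_norm_sub _ _ _).trans (add_le_add h he)
        _ = _ := one_mul _
    have hEi : Integrable (fun x => Complex.exp (Complex.I * ((t * V x : ℝ) : ℂ)) *
        ((Real.exp (-(t ^ 2 * v / 2)) : ℝ) : ℂ)) μ :=
      (integrable_cexp_I_mul ((BddMeas.const t).mul hVB).1 μ).mul_const _
    have hvi : Integrable (fun x => |vx x - v|) μ :=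
      (hvB.sub (BddMeas.const v)).abs.integrable μ
    have hA : ‖∫ x, F x ∂μ - (∫ x, Complex.exp (Complex.I * ((t * V x : ℝ) : ℂ)) ∂μ) *
        ((Real.exp (-(t ^ 2 * v / 2)) : ℝ) : ℂ)‖ ≤ K₀ / √N + t ^ 2 / 2 * (K₂ / √N) := by
      rw [← integral_mul_const, ← integral_sub hFi hEi]
      refine (norm_integral_le_of_norm_le ((integrable_const _).add (hvi.const_mul _))
        (ae_of_all _ hFx)).trans ?_
      simp only [Pi.add_apply]
      rw [integral_add (integrable_const _) (hvi.const_mul _), integral_const_mul]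
      simp only [integral_const, probReal_univ, one_smul]
      gcongr
    have hB := hK₁ N hN
    have hexp : Real.exp (-(t ^ 2 * M.predVariance χ y (n + 1) f / 2)) =
        Real.exp (-(t ^ 2 * M.filtVariance χ y n (fun z => ∫ z', f z' ∂(M.Q z)) / 2)) *
          Real.exp (-(t ^ 2 * v / 2)) := by
      rw [predVariance_succ_eq_add_filtVariance M χ hpos hb n hf, ← hv, ← Real.exp_add]
      congr 1
      ring
    have hle : ‖((Real.exp (-(t ^ 2 * v / 2)) : ℝ) : ℂ)‖ ≤ 1 := by
      rw [Complex.norm_real, Real.norm_eq_abs, Real.abs_exp]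
      exact Real.exp_le_one_iff.2 (neg_nonpos.2 (by positivity))
    have hB' : ‖(∫ x, Complex.exp (Complex.I * ((t * V x : ℝ) : ℂ)) ∂μ) *
        ((Real.exp (-(t ^ 2 * v / 2)) : ℝ) : ℂ) -
        ((Real.exp (-(t ^ 2 * M.predVariance χ y (n + 1) f / 2)) : ℝ) : ℂ)‖ ≤ K₁ / √N := by
      rw [hexp, Complex.ofReal_mul, ← sub_mul, norm_mul]
      calc _ ≤ K₁ / √N * 1 := mul_le_mul hB hle (norm_nonneg _) ((norm_nonneg _).trans hB)
        _ = _ := mul_one _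
    refine (norm_sub_le_norm_sub_add_norm_sub _ _ _).trans ((add_le_add hA hB').trans
      (le_of_eq ?_))
    ring

theorem tendsto_charFun_filtErr (hpos : ∀ x y, 0 < M.g x y)
    (hb : ∀ k, BddMeas fun x => M.g x (y k)) (n : ℕ)
    {f : X → ℝ} (hf : BddMeas f) (t : ℝ) :
    Tendsto (fun N : ℕ => ∫ x, Complex.exp (Complex.I * ((t * M.filtErr χ y n f x : ℝ) : ℂ))
        ∂(M.particleLaw hpos χ (Nat.succ_pos N) n y)) atTop
      (𝓝 ((Real.exp (-(t ^ 2 * M.filtVariance χ y n f / 2)) : ℝ) : ℂ)) := by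
  obtain ⟨K, hK⟩ := M.exists_charFun_filtErr_of_pred χ hpos hb n
    (fun f hf t => M.exists_charFun_predErr χ hpos hb n hf t) hf t
  rw [tendsto_iff_norm_sub_tendsto_zero]
  refine squeeze_zero (fun _ => norm_nonneg _) (fun N => hK (N + 1) (Nat.succ_pos N)) ?_
  refine tendsto_const_nhds.div_atTop (Real.tendsto_sqrt_atTop.comp ?_)
  exact tendsto_natCast_atTop_atTop.comp (tendsto_add_atTop_nat 1)

/-- Convergence of the moments of the rescaled particle filter error along a fixed sequence of
observations. -/
theorem tendsto_integral_abs_filtErr_rpow (hpos : ∀ x y, 0 < M.g x y)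
    (hb : ∀ k, BddMeas fun x => M.g x (y k)) (n : ℕ)
    {f : X → ℝ} (hf : BddMeas f) {p : ℝ} (hp : 0 < p) :
    Tendsto (fun N : ℕ => ∫ x, |M.filtErr χ y n f x| ^ p
        ∂(M.particleLaw hpos χ (Nat.succ_pos N) n y)) atTop
      (𝓝 ((2 * M.filtVariance χ y n f) ^ (p / 2) * (Real.Gamma ((p + 1) / 2) / √Real.pi))) := by
  obtain ⟨K, hK⟩ := M.exists_expMoment_filtErr_le χ hpos hb n hf zero_le_one
  simp only [one_mul] at hK
  exact tendsto_integral_abs_rpow_gaussian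
    (fun N => M.bddMeas_filtErr χ y hpos n hf (Nat.succ_pos N)) (M.filtVariance_nonneg χ y n f)
    (M.tendsto_charFun_filtErr χ hpos hb n hf) (fun N => hK (N + 1) (Nat.succ_pos N)) hp

theorem tendsto_sqrt_mul_integral_rpow (hpos : ∀ x y, 0 < M.g x y)
    (hb : ∀ k, BddMeas fun x => M.g x (y k)) (n : ℕ)
    {f : X → ℝ} (hf : BddMeas f) {p : ℝ} (hp : 0 < p) :
    Tendsto (fun N : ℕ => √((N + 1 : ℕ) : ℝ) *
        (∫ x, |(∫ z, f z ∂(M.partFilt (y n) x)) - ∫ z, f z ∂(M.filt χ y n)| ^ p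
          ∂(M.particleLaw hpos χ (Nat.succ_pos N) n y)) ^ (1 / p)) atTop
      (𝓝 (√2 * √(M.filtVariance χ y n f) *
        (Real.Gamma ((p + 1) / 2) / √Real.pi) ^ (1 / p))) := by
  have hv := M.filtVariance_nonneg χ y n f
  have hG : 0 ≤ Real.Gamma ((p + 1) / 2) / √Real.pi :=
    div_nonneg (Real.Gamma_pos_of_pos (by linarith)).le (Real.sqrt_nonneg _)
  -- The root is continuous at 0 as well, so a vanishing variance needs no separate case.
  have h := (M.tendsto_integral_abs_filtErr_rpow χ hpos hb n hf hp).rpow_const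
    (p := 1 / p) (Or.inr (by positivity))
  have hlim : ((2 * M.filtVariance χ y n f) ^ (p / 2) *
      (Real.Gamma ((p + 1) / 2) / √Real.pi)) ^ (1 / p) =
      √2 * √(M.filtVariance χ y n f) * (Real.Gamma ((p + 1) / 2) / √Real.pi) ^ (1 / p) := by
    rw [Real.mul_rpow (by positivity) hG, ← Real.rpow_mul (by positivity),
      ← Real.sqrt_mul (by norm_num), Real.sqrt_eq_rpow (2 * _)]
    congr 2
    field_simp
  rw [hlim] at h
  refine h.congr fun N => ?_
  have hs := Real.sqrt_nonneg ((N + 1 : ℕ) : ℝ)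
  have h1 : ∀ x : Fin (N + 1) → X, |M.filtErr χ y n f x| ^ p = √((N + 1 : ℕ) : ℝ) ^ p *
      |(∫ z, f z ∂(M.partFilt (y n) x)) - ∫ z, f z ∂(M.filt χ y n)| ^ p := by
    intro x
    rw [filtErr, abs_mul, abs_of_nonneg hs, Real.mul_rpow hs (abs_nonneg _)]
  simp_rw [h1]
  rw [integral_const_mul, Real.mul_rpow (by positivity)
    (integral_nonneg fun _ => Real.rpow_nonneg (abs_nonneg _) _), ← Real.rpow_mul hs,
    mul_one_div_cancel hp.ne', Real.rpow_one]

end HiddenMarkovModel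

/-! ### From conditional probabilities to joint laws -/

lemma measure_inter_eq_setLIntegral_of_condExp {Ω : Type*} {m m₀ : MeasurableSpace Ω}
    (hm : m ≤ m₀) (P : Measure Ω) [IsProbabilityMeasure P] {S B : Set Ω} (hS : MeasurableSet S)
    (hB : MeasurableSet[m] B) {κ : Ω → ℝ≥0∞} (hκ : Measurable κ) (hκ1 : ∀ ω, κ ω ≤ 1)
    (h : P[S.indicator (fun _ => (1 : ℝ)) | m] =ᵐ[P] fun ω => (κ ω).toReal) :
    P (S ∩ B) = ∫⁻ ω in B, κ ω ∂P := by
  have hi : Integrable (S.indicator fun _ => (1 : ℝ)) P := (integrable_const 1).indicator hS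
  have h1 := setIntegral_condExp hm hi hB
  rw [setIntegral_congr_ae (hm B hB) (h.mono fun ω hω _ => hω), integral_indicator hS,
    Measure.restrict_restrict hS, integral_const, smul_eq_mul, mul_one,
    integral_toReal hκ.aemeasurable (ae_of_all _ fun ω => (hκ1 ω).trans_lt
      ENNReal.one_lt_top)] at h1
  have h2 : ∫⁻ ω in B, κ ω ∂P ≠ ∞ := by
    refine ((lintegral_mono hκ1).trans_lt ?_).ne
    simp
  rw [measureReal_restrict_apply_univ] at h1
  exact ((ENNReal.toReal_eq_toReal_iff' h2 (measure_ne_top _ _)).1 h1).symm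

lemma measure_ext_prod_pi {α ι X : Type*} [Fintype ι] [MeasurableSpace α] [MeasurableSpace X]
    {μ ν : Measure (α × (ι → X))} [IsProbabilityMeasure μ] [IsProbabilityMeasure ν]
    (h : ∀ (B : Set α) (A : ι → Set X), MeasurableSet B → (∀ i, MeasurableSet (A i)) →
      μ (B ×ˢ Set.univ.pi A) = ν (B ×ˢ Set.univ.pi A)) : μ = ν := by
  have hgen := generateFrom_eq_prod (α := α) (β := ι → X)
    MeasurableSpace.generateFrom_measurableSet
    (generateFrom_pi (α := fun _ : ι => X)) isCountablySpanning_measurableSet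
    (IsCountablySpanning.pi fun _ => isCountablySpanning_measurableSet)
  refine ext_of_generate_finite _ hgen.symm
    (MeasurableSpace.isPiSystem_measurableSet.prod (isPiSystem_pi (α := fun _ : ι => X)))
    ?_ (by simp)
  rintro _ ⟨B, hB, _, ⟨A, hA, rfl⟩, rfl⟩
  exact h B A hB fun i => hA i (Set.mem_univ i)

namespace HiddenMarkovModel

variable {X Y : Type*} [MeasurableSpace X] [MeasurableSpace Y] (M : HiddenMarkovModel X Y)

/-! ### Dependence of the filter on the observations -/

lemma lkh_congr {y y' : ℕ → Y} (n : ℕ) (h : ∀ k < n, y k = y' k) :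
    M.lkh y 0 n = M.lkh y' 0 n := by
  induction n with
  | zero => rfl
  | succ n ih =>
    rw [lkh_succ M y (Nat.zero_le n), lkh_succ M y' (Nat.zero_le n),
      ih fun k hk => h k (hk.trans (Nat.lt_succ_self n)), h n (Nat.lt_succ_self n)]

lemma filt_congr (χ : Measure X) {y y' : ℕ → Y} (n : ℕ) (h : ∀ k ≤ n, y k = y' k) :
    M.filt χ y n = M.filt χ y' n := by
  rw [filt, filt, pred, pred, lkh_congr M n fun k hk => h k hk.le, h n le_rfl]

/-- Each `lkh` is a kernel for fixed observations only, so joint measurability needs its own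
induction. Letting F depend on the observations allows the weight g(·, y_n) to be absorbed into it.
-/
lemma measurable_lintegral_lkh (n : ℕ) {F : (ℕ → Y) × X → ℝ≥0∞} (hF : Measurable F) :
    Measurable fun q : (ℕ → Y) × X => ∫⁻ z, F (q.1, z) ∂(M.lkh q.1 0 n q.2) := by
  induction n generalizing F with
  | zero =>
    have h : ∀ q : (ℕ → Y) × X, ∫⁻ z, F (q.1, z) ∂(M.lkh q.1 0 0 q.2) = F q := by
      intro q
      have hFq : Measurable fun z => F (q.1, z) := hF.comp measurable_prodMk_left
      rw [lkh_self, Kernel.id_apply, lintegral_dirac' _ hFq]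
    simpa only [h] using hF
  | succ n ih =>
    have hG : Measurable fun q : (ℕ → Y) × X =>
        ENNReal.ofReal (M.g q.2 (q.1 n)) * ∫⁻ z', F (q.1, z') ∂(M.Q q.2) := by
      have h1 : Measurable fun q : (ℕ → Y) × X => M.g q.2 (q.1 n) := by
        change Measurable (Function.uncurry M.g ∘ fun q : (ℕ → Y) × X => (q.2, q.1 n))
        exact M.measurable_g.comp
          (measurable_snd.prodMk ((measurable_pi_apply n).comp measurable_fst))
      have h2 : Measurable fun r : ((ℕ → Y) × X) × X => F (r.1.1, r.2) :=
        hF.comp ((measurable_fst.comp measurable_fst).prodMk measurable_snd)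
      exact h1.ennreal_ofReal.mul
        (h2.lintegral_kernel_prod_right' (κ := M.Q.comap Prod.snd measurable_snd))
    have h : ∀ q : (ℕ → Y) × X, ∫⁻ z, F (q.1, z) ∂(M.lkh q.1 0 (n + 1) q.2) =
        ∫⁻ z, ENNReal.ofReal (M.g z (q.1 n)) * ∫⁻ z', F (q.1, z') ∂(M.Q z)
          ∂(M.lkh q.1 0 n q.2) := by
      intro q
      have hFq : Measurable fun z => F (q.1, z) := hF.comp measurable_prodMk_left
      rw [lkh_succ M q.1 (Nat.zero_le n), Kernel.lintegral_comp _ _ _ hFq]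
      simp only [stepKernel_apply, lintegral_smul_measure, smul_eq_mul]
    simp only [h]
    exact ih hG

lemma measurable_lintegral_filt (χ : Measure X) [IsProbabilityMeasure χ] (n : ℕ) {f : X → ℝ≥0∞}
    (hf : Measurable f) : Measurable fun y : ℕ → Y => ∫⁻ z, f z ∂(M.filt χ y n) := by
  have key : ∀ {F : (ℕ → Y) × X → ℝ≥0∞}, Measurable F →
      Measurable fun y : ℕ → Y => ∫⁻ z, F (y, z) ∂(M.pred χ y n) := by
    intro F hF
    have h : ∀ y : ℕ → Y, ∫⁻ z, F (y, z) ∂(M.pred χ y n) =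
        (∫⁻ x, ∫⁻ _, 1 ∂(M.lkh y 0 n x) ∂χ)⁻¹ * ∫⁻ x, ∫⁻ z, F (y, z) ∂(M.lkh y 0 n x) ∂χ := by
      intro y
      have hFy : Measurable fun z => F (y, z) := hF.comp measurable_prodMk_left
      rw [pred, lintegral_smul_measure, ← lintegral_one, smul_eq_mul,
        Measure.lintegral_bind (Kernel.aemeasurable _) aemeasurable_const,
        Measure.lintegral_bind (Kernel.aemeasurable _) hFy.aemeasurable]
    simp only [h]
    exact (M.measurable_lintegral_lkh n measurable_const).lintegral_prod_right'.inv.mul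
      (M.measurable_lintegral_lkh n hF).lintegral_prod_right'
  have hg : Measurable fun q : (ℕ → Y) × X => ENNReal.ofReal (M.g q.2 (q.1 n)) := by
    change Measurable (ENNReal.ofReal ∘ Function.uncurry M.g ∘
      fun q : (ℕ → Y) × X => (q.2, q.1 n))
    exact ENNReal.measurable_ofReal.comp (M.measurable_g.comp
      (measurable_snd.prodMk ((measurable_pi_apply n).comp measurable_fst)))
  have h : ∀ y : ℕ → Y, ∫⁻ z, f z ∂(M.filt χ y n) =
      (∫⁻ z, ENNReal.ofReal (M.g z (y n)) ∂(M.pred χ y n))⁻¹ *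
        ∫⁻ z, ENNReal.ofReal (M.g z (y n)) * f z ∂(M.pred χ y n) := by
    intro y
    rw [filt, update, lintegral_smul_measure, smul_eq_mul,
      lintegral_withDensity_eq_lintegral_mul _ (M.measurable_g_left _).ennreal_ofReal hf]
    rfl
  simp only [h]
  exact (key hg).inv.mul (key (hg.mul (hf.comp measurable_snd)))

/-- On the observation sequences with bounded likelihoods the filter is a measurable function of the
observations. -/
lemma exists_measurable_eq_integral_filt (hpos : ∀ x y, 0 < M.g x y) (χ : Measure X)
    [IsProbabilityMeasure χ] (n : ℕ) {f : X → ℝ} (hf : BddMeas f) :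
    ∃ F : (ℕ → Y) → ℝ, Measurable F ∧ (∃ C, ∀ y, |F y| ≤ C) ∧
      ∀ y : ℕ → Y, (∀ k, BddMeas fun x => M.g x (y k)) → F y = ∫ z, f z ∂(M.filt χ y n) := by
  obtain ⟨C, hC0, hC⟩ := hf.exists_nonneg_bound
  have hm : Measurable fun y : ℕ → Y =>
      (∫⁻ z, ENNReal.ofReal (f z + C) ∂(M.filt χ y n)).toReal - C :=
    (M.measurable_lintegral_filt χ n
      (hf.1.add measurable_const).ennreal_ofReal).ennreal_toReal.sub_const C
  -- Adding C makes the integrand nonnegative. The clipping keeps F bounded on exceptional sequences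
  -- and has no effect where the filter is a probability measure.
  refine ⟨fun y => max (-C) (min C ((∫⁻ z, ENNReal.ofReal (f z + C) ∂(M.filt χ y n)).toReal - C)),
    measurable_const.max (measurable_const.min hm), ⟨C, fun y => ?_⟩, fun y hb => ?_⟩
  · exact abs_le.2 ⟨le_max_left _ _, max_le (by linarith) (min_le_left _ _)⟩
  · have := M.isProbabilityMeasure_filt χ hpos hb n
    have hle := abs_le.1 (BddMeas.abs_integral_le hC (M.filt χ y n))
    have h1 : (∫⁻ z, ENNReal.ofReal (f z + C) ∂(M.filt χ y n)).toReal - C =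
        ∫ z, f z ∂(M.filt χ y n) := by
      rw [← integral_eq_lintegral_of_nonneg_ae (f := fun z => f z + C)
        (ae_of_all _ fun z => by simpa using by linarith [(abs_le.1 (hC z)).1])
        (hf.1.add measurable_const).aestronglyMeasurable,
        integral_add (hf.integrable _) (integrable_const _)]
      simp
    simp only [h1]
    rw [min_eq_right hle.2, max_eq_right hle.1]

/-! ### The joint law of the observations and the particles -/

section Law

variable {Ω : Type*} [MeasurableSpace Ω] (P : Measure Ω)

/-- The logarithm is ∞ at ∞, so its finite integral forces a finite supremum for almost every value
of Y_0; stationarity carries this to every time. -/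
lemma ae_bddMeas_likelihood {obs : ℕ → Ω → Y} (hstat : IsStationarySeq P obs)
    (hA2 : M.LikelihoodAssumption P obs) :
    ∀ᵐ ω ∂P, ∀ k, BddMeas fun x => M.g x (obs k ω) := by
  have h0 : ∀ᵐ y ∂(P.map (obs 0)), M.supLikelihood y ≠ ∞ := by
    have hm : AEMeasurable (fun y => (ENNReal.log (M.supLikelihood y)).toENNReal)
        (P.map (obs 0)) :=
      (ENNReal.continuous_log.measurable.comp_aemeasurable hA2.aemeasurable_sup).ereal_toENNReal
    filter_upwards [ae_lt_top' hm hA2.lintegral_log_lt_top.ne] with y hy htop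
    simp [htop] at hy
  rw [ae_all_iff]
  intro k
  have hmap : P.map (obs k) = P.map (obs 0) := by
    have hmeas : Measurable fun ω (i : ℕ) => obs (i + k) ω :=
      measurable_pi_lambda _ fun i => hstat.measurable_obs _
    have h := congrArg (Measure.map fun z : ℕ → Y => z 0) (hstat.shift_eq k)
    rw [Measure.map_map (measurable_pi_apply 0) hmeas,
      Measure.map_map (measurable_pi_apply 0) (measurable_pi_lambda _ hstat.measurable_obs)] at h
    simpa [Function.comp_def] using h
  rw [← hmap] at h0
  filter_upwards [ae_of_ae_map (hstat.measurable_obs k).aemeasurable h0] with ω hω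
  refine ⟨M.measurable_g_left _, (M.supLikelihood (obs k ω)).toReal, fun x => ?_⟩
  rw [abs_of_nonneg (M.g_nonneg _ _), ← ENNReal.toReal_ofReal (M.g_nonneg x (obs k ω))]
  exact ENNReal.toReal_mono hω (le_iSup (fun x => ENNReal.ofReal (M.g x (obs k ω))) x)

variable [IsProbabilityMeasure P] (hpos : ∀ x y, 0 < M.g x y) (χ : Measure X)
  [IsProbabilityMeasure χ] {N : ℕ} (hN : 0 < N)

/-- Given the observations, the particles at time `n` are distributed according to
`particleLaw`. -/
theorem map_obs_particle_eq_compProd {obs : ℕ → Ω → Y} (hobs : ∀ k, Measurable (obs k))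
    {ξ : ℕ → Fin N → Ω → X} (hξ : M.IsBootstrapFilter χ P obs N ξ) (n : ℕ) :
    P.map (fun ω => ((fun k => obs k ω, fun i => ξ n i ω) : (ℕ → Y) × (Fin N → X))) =
      (P.map fun ω k => obs k ω) ⊗ₘ M.particleLaw hpos χ hN n := by
  have hY : Measurable fun ω (k : ℕ) => obs k ω := measurable_pi_lambda _ hobs
  have hξm : ∀ n, Measurable fun ω i => ξ n i ω := fun n =>
    measurable_pi_lambda _ (hξ.measurable_particle n)
  have hS : ∀ (n : ℕ) (A : Fin N → Set X), (∀ i, MeasurableSet (A i)) →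
      MeasurableSet {ω | ∀ i, ξ n i ω ∈ A i} := fun n A hA => by
    rw [Set.ofPred_forall]
    exact MeasurableSet.iInter fun i => hξ.measurable_particle n i (hA i)
  have hprobY : IsProbabilityMeasure (P.map fun ω (k : ℕ) => obs k ω) :=
    Measure.isProbabilityMeasure_map hY.aemeasurable
  have hprob : ∀ n, IsProbabilityMeasure
      (P.map (fun ω => ((fun k => obs k ω, fun i => ξ n i ω) : (ℕ → Y) × (Fin N → X)))) :=
    fun n => Measure.isProbabilityMeasure_map (hY.prodMk (hξm n)).aemeasurable
  have hpre : ∀ (n : ℕ) (B : Set (ℕ → Y)) (A : Fin N → Set X),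
      (fun ω => ((fun k => obs k ω, fun i => ξ n i ω) : (ℕ → Y) × (Fin N → X))) ⁻¹'
        (B ×ˢ Set.univ.pi A) = {ω | ∀ i, ξ n i ω ∈ A i} ∩ (fun ω k => obs k ω) ⁻¹' B := by
    intro n B A
    ext ω
    simp [and_comm]
  induction n with
  | zero =>
    refine measure_ext_prod_pi fun B A hB hA => ?_
    rw [Measure.map_apply (hY.prodMk (hξm 0)) (hB.prod (MeasurableSet.univ_pi hA)), hpre,
      Measure.compProd_apply_prod hB (MeasurableSet.univ_pi hA)]
    rw [measure_inter_eq_setLIntegral_of_condExp hY.comap_le P (hS 0 A hA) ⟨B, hB, rfl⟩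
      (κ := fun _ => ∏ i, χ (A i)) measurable_const
      (fun _ => Finset.prod_le_one' fun i _ => prob_le_one)]
    · simp [particleLaw, Measure.map_apply hY hB]
    · simpa only [ENNReal.toReal_prod, Measure.real] using hξ.init A hA
  | succ n ih =>
    refine measure_ext_prod_pi fun B A hB hA => ?_
    have hpi := MeasurableSet.univ_pi hA
    rw [Measure.map_apply (hY.prodMk (hξm _)) (hB.prod hpi), hpre,
      Measure.compProd_apply_prod hB hpi]
    have hstep : Measurable fun q : (ℕ → Y) × (Fin N → X) =>
        M.particleStepAt hpos hN n q (Set.univ.pi A) :=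
      (M.particleStepAt hpos hN n).measurable_coe hpi
    have hval : ∀ q : (ℕ → Y) × (Fin N → X), M.particleStepAt hpos hN n q (Set.univ.pi A) =
        ∏ i, M.feynmanKac (q.1 n) (empirical q.2) (A i) := by
      intro q
      have := M.isProbabilityMeasure_feynmanKac_empirical hpos hN (q.1 n) q.2
      rw [particleStepAt, Kernel.comap_apply, particleStep_apply, Measure.pi_pi]
    have hm : MeasurableSpace.comap (fun ω (k : ℕ) => obs k ω) inferInstance ⊔
        MeasurableSpace.comap (fun ω (m : Fin (n + 1)) i => ξ m i ω) inferInstance ≤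
        (inferInstance : MeasurableSpace Ω) :=
      sup_le hY.comap_le (Measurable.comap_le (measurable_pi_lambda _ fun m => hξm m))
    rw [measure_inter_eq_setLIntegral_of_condExp hm P (hS (n + 1) A hA)
      (MeasurableSpace.le_def.1 le_sup_left _ ⟨B, hB, rfl⟩)
      (κ := fun ω => M.particleStepAt hpos hN n (fun k => obs k ω, fun i => ξ n i ω)
        (Set.univ.pi A)) (hstep.comp (hY.prodMk (hξm n))) (fun _ => prob_le_one)]
    -- The transition involves only the observations and the particles at time n, so their joint
    -- law, known by induction, suffices.
    · have h1 : ∫⁻ ω in (fun ω (k : ℕ) => obs k ω) ⁻¹' B, M.particleStepAt hpos hN n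
          (fun k => obs k ω, fun i => ξ n i ω) (Set.univ.pi A) ∂P =
          ∫⁻ q in B ×ˢ Set.univ, M.particleStepAt hpos hN n q (Set.univ.pi A)
            ∂(P.map (fun ω => ((fun k => obs k ω, fun i => ξ n i ω) :
              (ℕ → Y) × (Fin N → X)))) := by
        rw [setLIntegral_map (hB.prod MeasurableSet.univ) hstep (hY.prodMk (hξm n))]
        congr 2
        ext ω
        simp
      rw [h1, ih, Measure.setLIntegral_compProd hstep hB MeasurableSet.univ]
      refine lintegral_congr fun y => ?_
      rw [Measure.restrict_univ, particleLaw, Kernel.snd_apply' _ _ hpi,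
        Kernel.compProd_apply (measurable_snd hpi)]
      rfl
    · refine (hξ.step n A hA).trans (ae_of_all _ fun ω => ?_)
      simp only
      rw [hval, ENNReal.toReal_prod]
      rfl

/-- The conditional expectation of a function of the observations up to time `n` and the particles
at time `n`. -/
theorem condExp_particle {obs : ℕ → Ω → Y} (hobs : ∀ k, Measurable (obs k))
    {ξ : ℕ → Fin N → Ω → X} (hξ : M.IsBootstrapFilter χ P obs N ξ) (n : ℕ)
    {Φ : (Fin (n + 1) → Y) × (Fin N → X) → ℝ} (hΦ : BddMeas Φ) :
    P[fun ω => Φ (fun k => obs k ω, fun i => ξ n i ω) |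
        MeasurableSpace.comap (fun ω (k : Fin (n + 1)) => obs k ω) inferInstance] =ᵐ[P]
      fun ω => ∫ x, Φ (fun k => obs k ω, x) ∂(M.particleLaw hpos χ hN n fun k => obs k ω) := by
  have hY : Measurable fun ω (k : ℕ) => obs k ω := measurable_pi_lambda _ hobs
  have hZ : Measurable fun ω (k : Fin (n + 1)) => obs k ω := measurable_pi_lambda _ fun k => hobs k
  have hξm : Measurable fun ω i => ξ n i ω := measurable_pi_lambda _ (hξ.measurable_particle n)
  set R : (ℕ → Y) → Fin (n + 1) → Y := fun y k => y k with hR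
  have hRm : Measurable R := measurable_pi_lambda _ fun k => measurable_pi_apply _
  -- Periodic extension of a finite word to a sequence; the values beyond time n do not affect the
  -- particle law.
  set E : (Fin (n + 1) → Y) → ℕ → Y := fun z k => z (Fin.ofNat (n + 1) k) with hE
  have hEm : Measurable E := measurable_pi_lambda _ fun k => measurable_pi_apply _
  have hER : ∀ y : ℕ → Y, ∀ k < n + 1, E (R y) k = y k := by
    intro y k hk
    simp [hE, hR, Nat.mod_eq_of_lt hk]
  have hlaw : ∀ y : ℕ → Y, M.particleLaw hpos χ hN n (E (R y)) = M.particleLaw hpos χ hN n y :=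
    fun y => M.particleLaw_congr hpos χ hN n fun k hk => hER y k (hk.trans (Nat.lt_succ_self n))
  set ψ : (Fin (n + 1) → Y) → ℝ := fun z =>
    ∫ x, Φ (z, x) ∂(M.particleLaw hpos χ hN n (E z)) with hψ
  have hψB : BddMeas ψ := by
    obtain ⟨C, hC⟩ := hΦ.2
    refine ⟨?_, C, fun z => BddMeas.abs_integral_le (fun x => hC _) _⟩
    have h := hΦ.1.stronglyMeasurable.integral_kernel_prod_right'
      (κ := (M.particleLaw hpos χ hN n).comap E hEm)
    simpa only [Kernel.comap_apply] using h.measurable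
  have hmain : (fun ω => ψ fun k => obs k ω) =ᵐ[P]
      P[fun ω => Φ (fun k => obs k ω, fun i => ξ n i ω) |
        MeasurableSpace.comap (fun ω (k : Fin (n + 1)) => obs k ω) inferInstance] := by
    refine ae_eq_condExp_of_forall_setIntegral_eq hZ.comap_le
      ((hΦ.comp (hZ.prodMk hξm)).integrable P)
      (fun s _ _ => ((hψB.comp hZ).integrable P).integrableOn) ?_ ?_
    · rintro _ ⟨B, hB, rfl⟩ -
      have hΦ' : BddMeas fun q : (ℕ → Y) × (Fin N → X) => Φ (R q.1, q.2) :=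
        hΦ.comp ((hRm.comp measurable_fst).prodMk measurable_snd)
      have hB' : MeasurableSet (R ⁻¹' B) := hRm hB
      have hprobY : IsProbabilityMeasure (P.map fun ω (k : ℕ) => obs k ω) :=
        Measure.isProbabilityMeasure_map hY.aemeasurable
      have h1 : ∫ ω in (fun ω (k : Fin (n + 1)) => obs k ω) ⁻¹' B,
          Φ (fun k => obs k ω, fun i => ξ n i ω) ∂P =
          ∫ q in (R ⁻¹' B) ×ˢ Set.univ, Φ (R q.1, q.2)
            ∂(P.map (fun ω => ((fun k => obs k ω, fun i => ξ n i ω) :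
              (ℕ → Y) × (Fin N → X)))) := by
        rw [setIntegral_map (hB'.prod MeasurableSet.univ) hΦ'.1.aestronglyMeasurable
          (hY.prodMk hξm).aemeasurable]
        congr 2
        ext ω
        simp [hR]
      rw [h1, M.map_obs_particle_eq_compProd P hpos χ hN hobs hξ n,
        Measure.setIntegral_compProd hB' MeasurableSet.univ (hΦ'.integrable _).integrableOn]
      simp only [Measure.restrict_univ]
      have h2 : ∀ y : ℕ → Y, ∫ x, Φ (R y, x) ∂(M.particleLaw hpos χ hN n y) = ψ (R y) := by
        intro y
        rw [hψ]
        simp only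
        rw [hlaw]
      simp only [h2]
      rw [setIntegral_map hB' (hψB.comp hRm).1.aestronglyMeasurable hY.aemeasurable]
      rfl
    · exact (hψB.1.comp (comap_measurable _)).stronglyMeasurable.aestronglyMeasurable
  refine hmain.symm.trans (ae_of_all _ fun ω => ?_)
  have h3 := hlaw fun k => obs k ω
  rw [hψ]
  simp only
  rw [← h3]

end Law

end HiddenMarkovModel

end

/-! ### The almost sure limit of the conditional moments -/

theorem mainTheorem4 {X Y Ω : Type*} [MeasurableSpace X] [MeasurableSpace.CountablyGenerated X]
    [MeasurableSpace Y] [MeasurableSpace Ω] (P : Measure Ω) [IsProbabilityMeasure P]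
    (M : HiddenMarkovModel X Y)
    (obs : ℕ → Ω → Y) (hstat : IsStationarySeq P obs)
    (hA2 : M.LikelihoodAssumption P obs)
    (χ : Measure X) [IsProbabilityMeasure χ]
    (ξ : (N : ℕ) → ℕ → Fin N → Ω → X)
    (hξ : ∀ N, 0 < N → M.IsBootstrapFilter χ P obs N (ξ N))
    (h : X → ℝ) (h_meas : Measurable h) (h_bdd : ∃ C, ∀ x, |h x| ≤ C)
    (p : ℝ) (hp : 0 < p) (n : ℕ) :
    ∀ᵐ ω ∂P, Tendsto
      (fun N : ℕ => √(N : ℝ) *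
        ((P[fun ω' => |(∫ x, h x ∂(M.partFilt (obs n ω') (fun i => ξ N n i ω'))) -
              ∫ x, h x ∂(M.filt χ (fun k => obs k ω') n)| ^ p |
            MeasurableSpace.comap (fun ω' (k : Fin (n + 1)) => obs k ω') inferInstance]) ω)
          ^ (1 / p))
      atTop
      (𝓝 (√2 * √(M.filtVariance χ (fun k => obs k ω) n h) *
        (Real.Gamma ((p + 1) / 2) / √Real.pi) ^ (1 / p))) := by
  have hpos := hA2.pos
  have hh : BddMeas h := ⟨h_meas, h_bdd⟩
  have hgood := M.ae_bddMeas_likelihood P hstat hA2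
  obtain ⟨F, hFm, ⟨D, hD⟩, hF⟩ := M.exists_measurable_eq_integral_filt hpos χ n hh
  -- A single null set must serve all N, which is possible because they are countably many.
  have hcond : ∀ᵐ ω ∂P, ∀ N : ℕ,
      (P[fun ω' => |(∫ x, h x ∂(M.partFilt (obs n ω') (fun i => ξ (N + 1) n i ω'))) -
          ∫ x, h x ∂(M.filt χ (fun k => obs k ω') n)| ^ p |
        MeasurableSpace.comap (fun ω' (k : Fin (n + 1)) => obs k ω') inferInstance]) ω =
      ∫ x, |(∫ z, h z ∂(M.partFilt (obs n ω) x)) -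
          ∫ z, h z ∂(M.filt χ (fun k => obs k ω) n)| ^ p
        ∂(M.particleLaw hpos χ (Nat.succ_pos N) n fun k => obs k ω) := by
    rw [ae_all_iff]
    intro N
    set E : (Fin (n + 1) → Y) → ℕ → Y := fun z k => z (Fin.ofNat (n + 1) k) with hE
    have hEm : Measurable E := measurable_pi_lambda _ fun k => measurable_pi_apply _
    -- The filter mean is replaced by its version F, which is measurable and bounded on all
    -- sequences.
    set Φ : (Fin (n + 1) → Y) × (Fin (N + 1) → X) → ℝ := fun q =>
      |(∫ x, h x ∂(M.partFilt (q.1 (Fin.last n)) q.2)) - F (E q.1)| ^ p with hΦdef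
    have hΦ : BddMeas Φ := by
      obtain ⟨C, hC⟩ := h_bdd
      have hm : Measurable ((fun q : Y × (Fin (N + 1) → X) =>
          ∫ z, h z ∂(M.update q.1 (HiddenMarkovModel.empirical q.2))) ∘
            fun q : (Fin (n + 1) → Y) × (Fin (N + 1) → X) => (q.1 (Fin.last n), q.2)) :=
        (M.measurable_integral_update_empirical h_meas).comp
          (((measurable_pi_apply _).comp measurable_fst).prodMk measurable_snd)
      refine ⟨((hm.sub (hFm.comp (hEm.comp measurable_fst))).abs).pow_const p, (C + D) ^ p,
        fun q => ?_⟩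
      have := M.isProbabilityMeasure_update_empirical hpos (Nat.succ_pos N) (q.1 (Fin.last n)) q.2
      have h1 : |∫ x, h x ∂(M.partFilt (q.1 (Fin.last n)) q.2)| ≤ C :=
        BddMeas.abs_integral_le hC (M.update (q.1 (Fin.last n)) (HiddenMarkovModel.empirical q.2))
      rw [abs_of_nonneg (Real.rpow_nonneg (abs_nonneg _) _)]
      exact Real.rpow_le_rpow (abs_nonneg _)
        ((abs_sub _ _).trans (add_le_add h1 (hD _))) hp.le
    have hFE : ∀ᵐ ω ∂P, F (E fun k => obs k ω) = ∫ x, h x ∂(M.filt χ (fun k => obs k ω) n) := by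
      filter_upwards [hgood] with ω hω
      -- The periodic extension takes only observed values, so its likelihoods are bounded too.
      rw [hF _ fun k => hω _]
      refine congrArg (fun μ => ∫ x, h x ∂μ) (M.filt_congr χ n fun k hk => ?_)
      simp [Nat.mod_eq_of_lt (Nat.lt_succ_of_le hk)]
    have hcongr : (fun ω' => |(∫ x, h x ∂(M.partFilt (obs n ω') (fun i => ξ (N + 1) n i ω'))) -
          ∫ x, h x ∂(M.filt χ (fun k => obs k ω') n)| ^ p) =ᵐ[P]
        fun ω' => Φ (fun k => obs k ω', fun i => ξ (N + 1) n i ω') := by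
      filter_upwards [hFE] with ω hω
      simp only [hΦdef, hω, Fin.val_last]
    filter_upwards [condExp_congr_ae hcongr (m := MeasurableSpace.comap
        (fun ω' (k : Fin (n + 1)) => obs k ω') inferInstance),
      M.condExp_particle P hpos χ (Nat.succ_pos N) hstat.measurable_obs
        (hξ (N + 1) (Nat.succ_pos N)) n hΦ, hFE] with ω h1 h2 h3
    rw [h1, h2]
    simp only [hΦdef, h3, Fin.val_last]
  filter_upwards [hgood, hcond] with ω hb hc
  -- The index N = 0, with no particles, is dropped.
  rw [← tendsto_add_atTop_iff_nat 1]
  refine (M.tendsto_sqrt_mul_integral_rpow χ hpos hb n hh hp).congr fun N => ?_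
  rw [hc N]
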